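/- Let $k\ge 1$, $0<\gamma\le 1$, and let $P_0$ be a probability measure on $\mathbb{R}^k$. For a probability measure $P$ on $\mathbb{R}^k$ let $K_P(\gamma)$ be the set of measurable functions $\phi:\mathbb{R}^k\to[0,1]$ with $\int\phi\,dP\ge\gamma$ and $\int\|x\|^2\phi(x)\,P(dx)<\infty$. For $\phi\in K_P(\gamma)$ put $$T_P(\phi)=\frac{1}{\int\phi\,dP}\int x\,\phi(x)\,P(dx),\qquad C_P(\phi)=\frac{1}{\int\phi\,dP}\int (x-T_P(\phi))(x-T_P(\phi))'\phi(x)\,P(dx).$$ If $\phi$ minimizes $\det C_P$ over $K_P(\gamma)$, the pair $(T_P(\phi),C_P(\phi))$ is called an MCD functional at $P$. For $\mu\in\mathbb{R}^k$, a positive definite matrix $\Sigma$ and $\rho>0$ let $E(\mu,\Sigma,\rho)=\{x:(x-\mu)'\Sigma^{-1}(x-\mu)\le\rho^2\}$, let $r_P(\mu,\Sigma)=\inf\{s>0: P(E(\mu,\Sigma,s))\ge\gamma\}$, and put $r_P(\phi)=r_P(T_P(\phi),C_P(\phi))$. Let $X_1,X_2,\dots$ be independent random vectors with distribution $P_0$,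 and let $P_n$ be the empirical measure of $X_1,\dots,X_n$. For a subsample, i.e. a nonempty set of indices $S\subset\{1,\dots,n\}$, let $$\widehat T_n(S)=\frac1{|S|}\sum_{i\in S}X_i,\qquad \widehat C_n(S)=\frac1{|S|}\sum_{i\in S}(X_i-\widehat T_n(S))(X_i-\widehat T_n(S))',\qquad \widehat r_n(S)=r_{P_n}(\widehat T_n(S),\widehat C_n(S)),$$ where, only in order that $\widehat r_n(S)$ be defined for every sample, $\Sigma^{-1}$ is read as $0$ if $\Sigma$ is singular (this convention does not affect the result). For every $n\ge1$ let $S_n$ be a (random) subsample that minimizes $\det\widehat C_n(S)$ over all subsamples $S$ with $|S|\ge\lceil n\gamma\rceil$. **Theorem.** Suppose that $P_0(H)<\gamma$ for every hyperplane $H\subset\mathbb{R}^k$, and that there is exactly one MCD functional $(T_{P_0}(\phi_0),C_{P_0}(\phi_0))$ at $P_0$, where $\phi_0$ minimizes $\det C_{P_0}$ over $K_{P_0}(\gamma)$. Then (i) $(\widehat T_n(S_n),\widehat C_n(S_n))\to(T_{P_0}(\phi_0),C_{P_0}(\phi_0))$ with probability one. If, in addition, $P_0\big(E(T_{P_0}(\phi_0),C_{P_0}(\phi_0),r_{P_0}(\phi_0)+\varepsilon)\big)>\gamma$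 for all $\varepsilon>0$, then (ii) $\widehat r_n(S_n)\to r_{P_0}(\phi_0)$ with probability one. -/

import Mathlib

open MeasureTheory ProbabilityTheory Filter Topology

noncomputable section

namespace MCD

/-- `ℝ^k` with the Euclidean norm. -/
abbrev E (k : ℕ) : Type := EuclideanSpace ℝ (Fin k)

variable {k : ℕ}

/-- The class `K_P(γ)` of admissible trimming functions `φ : ℝ^k → [0,1]`. -/
structure IsTrimming (P : Measure (E k)) (γ : ℝ) (φ : E k → ℝ) : Prop where
  measurable : Measurable φ
  mem_Icc : ∀ x, φ x ∈ Set.Icc (0 : ℝ) 1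
  mass : γ ≤ ∫ x, φ x ∂P
  integrable_sq : Integrable (fun x => ‖x‖ ^ 2 * φ x) P

/-- The trimmed mean `T_P(φ) = (∫ φ dP)⁻¹ ∫ x φ(x) P(dx)`. -/
def trimmedMean (P : Measure (E k)) (φ : E k → ℝ) : E k :=
  (∫ x, φ x ∂P)⁻¹ • ∫ x, φ x • x ∂P

/-- The trimmed covariance matrix
`C_P(φ) = (∫ φ dP)⁻¹ ∫ (x - T_P(φ)) (x - T_P(φ))' φ(x) P(dx)`, entry by entry. -/
def trimmedCov (P : Measure (E k)) (φ : E k → ℝ) : Matrix (Fin k) (Fin k) ℝ :=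
  Matrix.of fun i j =>
    (∫ x, φ x ∂P)⁻¹ *
      ∫ x, (x i - trimmedMean P φ i) * (x j - trimmedMean P φ j) * φ x ∂P

/-- `φ` minimizes `det C_P` over `K_P(γ)`. -/
def IsMinimizing (P : Measure (E k)) (γ : ℝ) (φ : E k → ℝ) : Prop :=
  IsTrimming P γ φ ∧
    ∀ ψ, IsTrimming P γ ψ → (trimmedCov P φ).det ≤ (trimmedCov P ψ).det

/-- The pair `p` is an MCD functional at `P`. -/
def IsMCDFunctional (P : Measure (E k)) (γ : ℝ)
    (p : E k × Matrix (Fin k) (Fin k) ℝ) : Prop :=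
  ∃ φ, IsMinimizing P γ φ ∧ p = (trimmedMean P φ, trimmedCov P φ)

/-- The ellipsoid `{x : (x - m)' V⁻¹ (x - m) ≤ ρ²}`. -/
def ellipsoid (m : E k) (V : Matrix (Fin k) (Fin k) ℝ) (ρ : ℝ) : Set (E k) :=
  {x | (x - m).ofLp ⬝ᵥ (V⁻¹).mulVec (x - m).ofLp ≤ ρ ^ 2}

/-- `inf {s > 0 : P(E(m, V, s)) ≥ γ}`. -/
def radius (P : Measure (E k)) (γ : ℝ) (m : E k) (V : Matrix (Fin k) (Fin k) ℝ) : ℝ :=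
  sInf {s : ℝ | 0 < s ∧ γ ≤ P.real (ellipsoid m V s)}

/-- The radius `r_P(φ)`. -/
def trimmedRadius (P : Measure (E k)) (γ : ℝ) (φ : E k → ℝ) : ℝ :=
  radius P γ (trimmedMean P φ) (trimmedCov P φ)

/-- Every hyperplane of `ℝ^k` has `P`-mass strictly smaller than `γ`. -/
def HyperplaneCondition (P : Measure (E k)) (γ : ℝ) : Prop :=
  ∀ a : E k, a ≠ 0 → ∀ b : ℝ, P.real {x | inner ℝ a x = b} < γ

/-- There is mass directly outside the ellipsoid determined by `φ`. -/
def BoundaryCondition (P : Measure (E k)) (γ : ℝ) (φ : E k → ℝ) : Prop :=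
  ∀ ε : ℝ, 0 < ε →
    γ < P.real (ellipsoid (trimmedMean P φ) (trimmedCov P φ) (trimmedRadius P γ φ + ε))

/-! Samples `x₁, …, xₙ`. A subsample is a set of indices, so that observations
with equal values count separately. -/

/-- The empirical measure of a sample. -/
def empiricalMeasure {n : ℕ} (x : Fin n → E k) : Measure (E k) :=
  (n : ENNReal)⁻¹ • ∑ i, Measure.dirac (x i)

/-- The mean of a subsample. -/
def sampleMean {n : ℕ} (x : Fin n → E k) (S : Finset (Fin n)) : E k :=
  (S.card : ℝ)⁻¹ • ∑ i ∈ S, x i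

/-- The covariance matrix of a subsample. -/
def sampleCov {n : ℕ} (x : Fin n → E k) (S : Finset (Fin n)) : Matrix (Fin k) (Fin k) ℝ :=
  (S.card : ℝ)⁻¹ • ∑ i ∈ S,
    Matrix.vecMulVec (x i - sampleMean x S).ofLp (x i - sampleMean x S).ofLp

/-- The radius that belongs to a subsample, with respect to the empirical measure. -/
def sampleRadius {n : ℕ} (γ : ℝ) (x : Fin n → E k) (S : Finset (Fin n)) : ℝ :=
  radius (empiricalMeasure x) γ (sampleMean x S) (sampleCov x S)

/-- `S` minimizes the determinant of the subsample covariance matrix over all subsamples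
with at least `⌈nγ⌉` points. -/
def IsMinimizingSubsample {n : ℕ} (γ : ℝ) (x : Fin n → E k) (S : Finset (Fin n)) : Prop :=
  ⌈(n : ℝ) * γ⌉₊ ≤ S.card ∧
    ∀ S' : Finset (Fin n), ⌈(n : ℝ) * γ⌉₊ ≤ S'.card →
      (sampleCov x S).det ≤ (sampleCov x S').det

end MCD

end

noncomputable section

namespace MCD

variable {k : ℕ}

/-! For a law with mean `T` and covariance `C`, the average of the form `(x - m)' V⁻¹ (x - m)` is
`tr(V⁻¹ C) + (T - m)' V⁻¹ (T - m)`. If this is at most `k`, the inequality of arithmetic and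
geometric means gives `det C ≤ det V`, with equality only for `C = V`, `T = m`
(`det_le_det_of_trace_le`). Determinants are thus controlled by averages of one fixed quadratic
form.

A normalized part `ν` of `P` of mass at least `γ` satisfies `γ (c - ∫ g dν) ≤ ∫ (c - g)⁺ dP` for `g
≥ 0` (`IsTrimmedLaw.le_integral`). The right side no longer contains `ν` and is weakly continuous in
`P` and in the parameters of `g`. Conversely, these inequalities for all `c` produce a trimming
function whose `g`-average is as small as claimed (`exists_trimming_integral_le`).

The form built from a nonsingular subsample's own mean and covariance has average exactly `k`. Hence
at a cluster point `(m, V)` of the estimators some `φ` has average at most `k`, so `det C(φ) ≤ det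
V`. The law of large numbers, applied to a slight enlargement of `φ₀`, gives `det V ≤ det C(φ₀)`
(`ae_eventually_det_le`). All these determinants agree, so `(m, V)` is the MCD functional of `φ`,
and uniqueness identifies it. The hyperplane condition bounds trimmed laws away from degeneracy
uniformly near `P₀` (`exists_eventually_le_integral_sq`), which supplies compactness and nonsingular
limits. The radius then follows from the portmanteau theorem with moving ellipsoids. -/

/-! ### Determinant inequalities for quadratic forms -/

theorem prod_le_one_of_sum_le_card {ι : Type*} [Fintype ι] (l : ι → ℝ) (h0 : ∀ i, 0 ≤ l i)
    (hs : ∑ i, l i ≤ Fintype.card ι) : ∏ i, l i ≤ 1 ∧ (1 ≤ ∏ i, l i → ∀ i, l i = 1) := by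
  -- The bound `l ≤ exp (l - 1)`, strict unless `l = 1`, gives both the inequality and its equality
  -- case.
  have hexp : ∏ i, Real.exp (l i - 1) ≤ 1 := by
    rw [← Real.exp_sum, Real.exp_le_one_iff, Finset.sum_sub_distrib]
    simpa using hs
  have hle : ∀ i, l i ≤ Real.exp (l i - 1) := fun i => by
    simpa using Real.add_one_le_exp (l i - 1)
  refine ⟨(Finset.prod_le_prod (fun i _ => h0 i) fun i _ => hle i).trans hexp, fun h1 j => ?_⟩
  by_contra hj
  have hpos : ∀ i, 0 < l i := fun i => by
    refine lt_of_le_of_ne (h0 i) fun hi => ?_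
    rw [Finset.prod_eq_zero (Finset.mem_univ i) hi.symm] at h1
    linarith
  have hlt : l j < Real.exp (l j - 1) := by
    simpa using Real.add_one_lt_exp (sub_ne_zero.2 hj)
  have := Finset.prod_lt_prod (fun i _ => hpos i) (fun i _ => hle i)
    ⟨j, Finset.mem_univ j, hlt⟩
  linarith

theorem det_le_one_of_trace_le {M : Matrix (Fin k) (Fin k) ℝ} (hM : M.PosSemidef)
    (ht : M.trace ≤ k) : M.det ≤ 1 ∧ (1 ≤ M.det → M = 1) := by
  have hs : ∑ i, hM.1.eigenvalues i ≤ Fintype.card (Fin k) := by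
    have := hM.1.trace_eq_sum_eigenvalues
    simp only [RCLike.ofReal_real_eq_id, id] at this
    simpa [← this] using ht
  have hd : M.det = ∏ i, hM.1.eigenvalues i := by
    simpa using hM.1.det_eq_prod_eigenvalues
  obtain ⟨h1, h2⟩ := prod_le_one_of_sum_le_card _ hM.eigenvalues_nonneg hs
  rw [hd]
  refine ⟨h1, fun h => ?_⟩
  have h3 : hM.1.eigenvalues = fun _ => 1 := funext (h2 h)
  have h4 := hM.1.spectral_theorem
  rw [h3] at h4
  rw [h4]
  have : Matrix.diagonal ((RCLike.ofReal : ℝ → ℝ) ∘ fun _ : Fin k => (1 : ℝ)) = 1 := by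
    ext i j; simp [Matrix.diagonal, Matrix.one_apply]
  rw [this, map_one]

open scoped MatrixOrder in
theorem exists_inv_eq_conjTranspose_mul {V : Matrix (Fin k) (Fin k) ℝ} (hV : V.PosDef) :
    ∃ B : Matrix (Fin k) (Fin k) ℝ, V⁻¹ = B.transpose * B ∧ IsUnit B.det := by
  obtain ⟨B, hB⟩ := (Matrix.nonneg_iff_posSemidef.2 hV.inv.posSemidef : 0 ≤ V⁻¹) |>
    CStarAlgebra.nonneg_iff_eq_star_mul_self.1
  refine ⟨B, by simpa [Matrix.star_eq_conjTranspose] using hB, ?_⟩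
  have := hV.inv.det_pos
  rw [hB, Matrix.det_mul] at this
  exact isUnit_iff_ne_zero.2 (right_ne_zero_of_mul this.ne')

/-- The quadratic form `(x - m)' W (x - m)`. -/
def mahal (m : E k) (W : Matrix (Fin k) (Fin k) ℝ) (x : E k) : ℝ :=
  (x - m).ofLp ⬝ᵥ W.mulVec (x - m).ofLp

theorem mahal_nonneg {W : Matrix (Fin k) (Fin k) ℝ} (hW : W.PosSemidef) (m x : E k) :
    0 ≤ mahal m W x := by
  simpa [mahal] using hW.dotProduct_mulVec_nonneg (x - m).ofLp

/-- With `V⁻¹ = B' B` the form is `‖B (x - m)‖²`, and `‖B⁻¹‖²` serves as `c`. -/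
theorem exists_normSq_le_mahal {V : Matrix (Fin k) (Fin k) ℝ} (hV : V.PosDef) :
    ∃ c, 0 ≤ c ∧ ∀ m x : E k, ‖x - m‖ ^ 2 ≤ c * mahal m V⁻¹ x := by
  obtain ⟨B, hB, hu⟩ := exists_inv_eq_conjTranspose_mul hV
  refine ⟨‖Matrix.toEuclideanCLM (𝕜 := ℝ) B⁻¹‖ ^ 2, by positivity, fun m x => ?_⟩
  set y := x - m
  have h1 : y = Matrix.toEuclideanCLM (𝕜 := ℝ) B⁻¹ (Matrix.toEuclideanCLM (𝕜 := ℝ) B y) := by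
    rw [← mul_apply_eq_comp, ← map_mul, Matrix.nonsing_inv_mul _ hu, map_one]
    rfl
  have h2 : mahal m V⁻¹ x = ‖Matrix.toEuclideanCLM (𝕜 := ℝ) B y‖ ^ 2 := by
    rw [EuclideanSpace.real_norm_sq_eq]
    change y.ofLp ⬝ᵥ V⁻¹.mulVec y.ofLp = _
    rw [hB, ← Matrix.mulVec_mulVec, Matrix.dotProduct_mulVec, Matrix.vecMul_transpose]
    simp [dotProduct, sq]
  rw [h2, ← mul_pow]
  nth_rw 1 [h1]
  gcongr
  exact ContinuousLinearMap.le_opNorm _ _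

/-- Whitening by `V⁻¹ = B' B` turns `C` into `B C B'`, with trace `tr(V⁻¹ C) ≤ k` and determinant
`det C / det V`. Equality forces `B C B' = 1`; the trace then uses up all of `k`, and nothing is
left for the distance from `T` to `m`. -/
theorem det_le_det_of_trace_le {V C : Matrix (Fin k) (Fin k) ℝ} (hV : V.PosDef)
    (hC : C.PosSemidef) (T m : E k) (h : (V⁻¹ * C).trace + mahal m V⁻¹ T ≤ k) :
    C.det ≤ V.det ∧ (V.det ≤ C.det → C = V ∧ T = m) := by
  obtain ⟨B, hB, hu⟩ := exists_inv_eq_conjTranspose_mul hV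
  have hdV := hV.det_pos
  have hm := mahal_nonneg hV.inv.posSemidef m T
  have hM : (B * C * B.transpose).PosSemidef := by
    simpa using hC.mul_mul_conjTranspose_same B
  have htr : (B * C * B.transpose).trace = (V⁻¹ * C).trace := by
    rw [Matrix.trace_mul_comm, ← Matrix.mul_assoc, hB]
  have hdet : (B * C * B.transpose).det = C.det / V.det := by
    have : B.det * B.det = V.det⁻¹ := by
      have := congrArg Matrix.det hB
      rw [Matrix.det_mul, Matrix.det_transpose, Matrix.det_nonsing_inv, Ring.inverse_eq_inv'] at this
      exact this.symm
    rw [Matrix.det_mul, Matrix.det_mul, Matrix.det_transpose, div_eq_mul_inv, ← this]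
    ring
  obtain ⟨h1, h2⟩ := det_le_one_of_trace_le hM (by linarith)
  rw [hdet] at h1 h2
  refine ⟨(div_le_one hdV).1 h1, fun h3 => ?_⟩
  have h4 := h2 ((one_le_div hdV).2 h3)
  have h5 : C = V := by
    have e : V⁻¹ * C = 1 := by
      have e1 : B * (C * B.transpose) = 1 := by rw [← Matrix.mul_assoc, h4]
      have e2 := mul_eq_one_comm.1 e1
      rw [hB]
      have e3 : C * (B.transpose * B) = 1 := by rw [← Matrix.mul_assoc, e2]
      exact mul_eq_one_comm.1 e3
    have := congrArg (V * ·) e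
    simpa [← Matrix.mul_assoc, Matrix.mul_nonsing_inv _ hdV.ne'.isUnit] using this
  refine ⟨h5, ?_⟩
  have h6 : (V⁻¹ * C).trace = k := by
    rw [← htr, h4]; simp
  obtain ⟨c, hc, hcm⟩ := exists_normSq_le_mahal hV
  have h7 : mahal m V⁻¹ T = 0 := by linarith
  have h8 := hcm m T
  rw [h7, mul_zero] at h8
  have : ‖T - m‖ = 0 := by nlinarith [norm_nonneg (T - m)]
  exact sub_eq_zero.1 (norm_eq_zero.1 this)

/-- All eigenvalues are at least `l`, so each is at most the determinant divided by `l ^ (k - 1)`.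
-/
theorem trace_le_of_det_le {V : Matrix (Fin k) (Fin k) ℝ} (hV : V.PosSemidef) {l D : ℝ}
    (hl : 0 < l) (h : ∀ a : E k, l * ‖a‖ ^ 2 ≤ mahal 0 V a) (hD : V.det ≤ D) :
    V.trace ≤ k * (D / l ^ (k - 1)) := by
  have hev : ∀ i, l ≤ hV.1.eigenvalues i := fun i => by
    have h1 := h (hV.1.eigenvectorBasis i)
    have h2 := hV.1.mulVec_eigenvectorBasis i
    have h3 : (hV.1.eigenvectorBasis i).ofLp ⬝ᵥ (hV.1.eigenvectorBasis i).ofLp = 1 := by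
      have := hV.1.eigenvectorBasis.norm_eq_one i
      have h4 := EuclideanSpace.real_norm_sq_eq (hV.1.eigenvectorBasis i)
      rw [this] at h4
      simpa [dotProduct, sq] using h4.symm
    simp only [mahal, sub_zero, h2, dotProduct_smul, h3] at h1
    simpa [hV.1.eigenvectorBasis.norm_eq_one i] using h1
  have htr : V.trace = ∑ i, hV.1.eigenvalues i := by
    simpa using hV.1.trace_eq_sum_eigenvalues
  have hd : V.det = ∏ i, hV.1.eigenvalues i := by
    simpa using hV.1.det_eq_prod_eigenvalues
  rw [htr]
  calc ∑ i, hV.1.eigenvalues i ≤ ∑ _i : Fin k, D / l ^ (k - 1) := by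
        refine Finset.sum_le_sum fun i _ => ?_
        rw [le_div_iff₀ (by positivity)]
        refine le_trans ?_ hD
        rw [hd, ← Finset.mul_prod_erase _ _ (Finset.mem_univ i)]
        refine mul_le_mul_of_nonneg_left ?_ (hl.le.trans (hev i))
        calc l ^ (k - 1) = ∏ _j ∈ Finset.univ.erase i, l := by simp
          _ ≤ _ := Finset.prod_le_prod (fun _ _ => hl.le) fun j _ => hev j
    _ = _ := by simp

/-! ### Mean and covariance of a law -/

/-- The mean of a law on `ℝ^k`. -/
def meanOf (ν : Measure (E k)) : E k := ∫ x, x ∂ν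

/-- The covariance matrix of a law on `ℝ^k`. -/
def covOf (ν : Measure (E k)) : Matrix (Fin k) (Fin k) ℝ :=
  Matrix.of fun i j => ∫ x, (x i - meanOf ν i) * (x j - meanOf ν j) ∂ν

section Moments

variable {ν : Measure (E k)} [IsProbabilityMeasure ν]

theorem memLp_coord_sub (h : MemLp (fun x : E k => x) 2 ν) (c : ℝ) (i : Fin k) :
    MemLp (fun x : E k => x i - c) 2 ν :=
  ((EuclideanSpace.proj (𝕜 := ℝ) i).comp_memLp' h).sub (memLp_const c)

theorem integrable_coord_mul (h : MemLp (fun x : E k => x) 2 ν) (c d : ℝ) (i j : Fin k) :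
    Integrable (fun x : E k => (x i - c) * (x j - d)) ν :=
  (memLp_coord_sub h c i).integrable_mul (memLp_coord_sub h d j)

theorem integral_coord (h : MemLp (fun x : E k => x) 2 ν) (i : Fin k) :
    ∫ x, x i ∂ν = meanOf ν i :=
  (EuclideanSpace.proj (𝕜 := ℝ) i).integral_comp_comm (h.integrable one_le_two)

theorem integral_coord_mul (h : MemLp (fun x : E k => x) 2 ν) (m : E k) (i j : Fin k) :
    ∫ x, (x i - m i) * (x j - m j) ∂ν =
      covOf ν i j + (meanOf ν i - m i) * (meanOf ν j - m j) := by
  have hi : ∀ i, Integrable (fun x : E k => x i - meanOf ν i) ν := fun i =>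
    (memLp_coord_sub h _ i).integrable one_le_two
  have h0 : ∀ i, ∫ x, (x i - meanOf ν i) ∂ν = 0 := fun i => by
    have hx : Integrable (fun x : E k => x i) ν :=
      (EuclideanSpace.proj (𝕜 := ℝ) i).integrable_comp (h.integrable one_le_two)
    rw [integral_sub hx (integrable_const _), integral_coord h]
    simp
  have e : ∀ x : E k, (x i - m i) * (x j - m j) =
      (x i - meanOf ν i) * (x j - meanOf ν j) +
        ((meanOf ν j - m j) * (x i - meanOf ν i) + ((meanOf ν i - m i) * (x j - meanOf ν j) +
          (meanOf ν i - m i) * (meanOf ν j - m j))) := fun x => by ring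
  rw [integral_congr_ae (ae_of_all _ e), integral_add (integrable_coord_mul h _ _ i j), integral_add, integral_add,
    integral_const_mul, integral_const_mul, h0, h0]
  · rw [integral_const, probReal_univ, one_smul, mul_zero, mul_zero, zero_add, zero_add]
    rfl
  · exact (hi j).const_mul _
  · exact integrable_const _
  · exact (hi i).const_mul _
  · exact ((hi j).const_mul _).add (integrable_const _)
  · exact ((hi i).const_mul _).add (((hi j).const_mul _).add (integrable_const _))

theorem mahal_eq_sum (m : E k) (W : Matrix (Fin k) (Fin k) ℝ) (x : E k) :
    mahal m W x = ∑ i, ∑ j, W i j * ((x j - m j) * (x i - m i)) := by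
  simp only [mahal, dotProduct, Matrix.mulVec, Finset.mul_sum]
  refine Finset.sum_congr rfl fun i _ => Finset.sum_congr rfl fun j _ => ?_
  simp only [PiLp.sub_apply]
  ring

theorem continuous_mahal :
    Continuous fun p : E k × (E k × Matrix (Fin k) (Fin k) ℝ) => mahal p.2.1 p.2.2 p.1 := by
  simp only [mahal_eq_sum]
  fun_prop

omit [IsProbabilityMeasure ν] in
theorem measurable_mahal (m : E k) (W : Matrix (Fin k) (Fin k) ℝ) : Measurable (mahal m W) := by
  have : mahal m W = fun x => ∑ i, ∑ j, W i j * ((x j - m j) * (x i - m i)) :=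
    funext (mahal_eq_sum m W)
  rw [this]
  fun_prop

theorem integrable_mahal (h : MemLp (fun x : E k => x) 2 ν) (m : E k)
    (W : Matrix (Fin k) (Fin k) ℝ) : Integrable (mahal m W) ν := by
  have : mahal m W = fun x => ∑ i, ∑ j, W i j * ((x j - m j) * (x i - m i)) :=
    funext (mahal_eq_sum m W)
  rw [this]
  exact integrable_finsetSum _ fun i _ => integrable_finsetSum _ fun j _ =>
    (integrable_coord_mul h _ _ j i).const_mul _

theorem integral_mahal (h : MemLp (fun x : E k => x) 2 ν) (m : E k)
    (W : Matrix (Fin k) (Fin k) ℝ) :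
    ∫ x, mahal m W x ∂ν = (W * covOf ν).trace + mahal m W (meanOf ν) := by
  simp_rw [mahal_eq_sum]
  have hI : ∀ i j, Integrable (fun x : E k => W i j * ((x j - m j) * (x i - m i))) ν :=
    fun i j => (integrable_coord_mul h _ _ j i).const_mul _
  rw [integral_finsetSum _ fun i _ => integrable_finsetSum _ fun j _ => hI i j]
  simp_rw [integral_finsetSum _ fun j _ => hI _ j, integral_const_mul, integral_coord_mul h,
    mul_add, Finset.sum_add_distrib]
  rfl

omit [IsProbabilityMeasure ν] in
theorem covOf_isHermitian : (covOf ν).IsHermitian := by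
  ext i j
  simp [covOf, mul_comm]

theorem mahal_covOf (h : MemLp (fun x : E k => x) 2 ν) (a : E k) :
    mahal 0 (covOf ν) a = ∫ x, (inner ℝ a x - inner ℝ a (meanOf ν)) ^ 2 ∂ν := by
  -- The square is the quadratic form of the rank-one matrix `a a'`, so `integral_mahal` applies.
  have e : ∀ x : E k, (inner ℝ a x - inner ℝ a (meanOf ν)) ^ 2 =
      mahal (meanOf ν) (Matrix.of fun i j => a i * a j) x := fun x => by
    rw [← inner_sub_right, mahal_eq_sum, PiLp.inner_apply, sq, Finset.sum_mul_sum]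
    refine Finset.sum_congr rfl fun i _ => Finset.sum_congr rfl fun j _ => ?_
    simp
    ring
  simp_rw [e]
  rw [integral_mahal h, mahal_eq_sum, mahal_eq_sum]
  simp only [sub_self, mul_zero, Finset.sum_const_zero, add_zero, Matrix.trace, Matrix.diag,
    Matrix.mul_apply, Matrix.of_apply]
  refine Finset.sum_congr rfl fun i _ => Finset.sum_congr rfl fun j _ => ?_
  have : covOf ν j i = covOf ν i j := by simp [covOf, mul_comm]
  rw [this]
  simp
  ring

theorem covOf_posSemidef (h : MemLp (fun x : E k => x) 2 ν) : (covOf ν).PosSemidef := by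
  refine .of_dotProduct_mulVec_nonneg covOf_isHermitian fun x => ?_
  have := mahal_covOf h (WithLp.toLp 2 x)
  simp only [mahal, sub_zero] at this
  simp only [star_trivial, this]
  positivity

theorem abs_covOf_le_trace (h : MemLp (fun x : E k => x) 2 ν) (i j : Fin k) :
    |covOf ν i j| ≤ (covOf ν).trace := by
  have hd : ∀ i, covOf ν i i ≤ (covOf ν).trace := fun i =>
    Finset.single_le_sum (f := fun i => covOf ν i i)
      (fun i _ => (covOf_posSemidef h).diag_nonneg) (Finset.mem_univ i)
  have hi := integrable_coord_mul h (meanOf ν i) (meanOf ν i) i i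
  have hj := integrable_coord_mul h (meanOf ν j) (meanOf ν j) j j
  have h1 : |covOf ν i j| ≤ (covOf ν i i + covOf ν j j) / 2 := by
    have : (covOf ν i i + covOf ν j j) / 2 = ∫ x, ((x i - meanOf ν i) * (x i - meanOf ν i) +
        (x j - meanOf ν j) * (x j - meanOf ν j)) / 2 ∂ν := by
      rw [integral_div, integral_add hi hj]; rfl
    rw [this]
    refine abs_integral_le_integral_abs.trans (integral_mono
      (integrable_coord_mul h _ _ i j).abs ((hi.add hj).div_const 2) fun x => ?_)
    simp only
    rw [abs_le]
    constructor <;> nlinarith [sq_nonneg ((x i - meanOf ν i) + (x j - meanOf ν j)),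
      sq_nonneg ((x i - meanOf ν i) - (x j - meanOf ν j))]
  linarith [hd i, hd j]

theorem mahal_covOf_le (h : MemLp (fun x : E k => x) 2 ν) (a : E k) :
    mahal 0 (covOf ν) a ≤ ‖a‖ ^ 2 * (covOf ν).trace := by
  have ht : (covOf ν).trace = ∫ x, ‖x - meanOf ν‖ ^ 2 ∂ν := by
    simp_rw [EuclideanSpace.real_norm_sq_eq]
    rw [integral_finsetSum]
    · simp [Matrix.trace, covOf, sq]
    · intro i _
      simpa [sq] using integrable_coord_mul h _ _ i i
  have hI : Integrable (fun x => ‖x - meanOf ν‖ ^ 2) ν :=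
    (h.sub (memLp_const _)).integrable_norm_pow two_ne_zero
  rw [mahal_covOf h, ht, ← integral_const_mul]
  refine integral_mono_of_nonneg (ae_of_all _ fun x => by positivity) (hI.const_mul _)
    (ae_of_all _ fun x => ?_)
  simp only
  rw [← inner_sub_right, ← mul_pow, sq_le_sq, abs_of_nonneg (a := ‖a‖ * _) (by positivity)]
  exact abs_real_inner_le_norm _ _

end Moments

/-! ### Trimmed laws -/

/-- The normalized parts of `P` that carry mass at least `γ` and have a second moment. -/
structure IsTrimmedLaw (P : Measure (E k)) (γ : ℝ) (ν : Measure (E k)) : Prop where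
  prob : IsProbabilityMeasure ν
  memLp : MemLp (fun x : E k => x) 2 ν
  dominated : ∃ q, γ ≤ q ∧ ENNReal.ofReal q • ν ≤ P

/-- Bound `c - g` by its positive part and use `q • ν ≤ P`. The absolute value changes nothing for
`g ≥ 0`, but keeps the integrand bounded for every real `g`, as weak convergence requires. -/
theorem IsTrimmedLaw.le_integral {P ν : Measure (E k)} [IsFiniteMeasure P] {γ : ℝ}
    (hν : IsTrimmedLaw P γ ν) (hγ : 0 ≤ γ) {g : E k → ℝ} (hg : Measurable g) (hg0 : ∀ x, 0 ≤ g x)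
    (hgi : Integrable g ν) (c : ℝ) :
    γ * (c - ∫ x, g x ∂ν) ≤ ∫ x, max 0 (c - |g x|) ∂P := by
  have := hν.prob
  obtain ⟨q, hq, hle⟩ := hν.dominated
  rcases le_total (c - ∫ x, g x ∂ν) 0 with h | h
  · exact (mul_nonpos_of_nonneg_of_nonpos hγ h).trans
      (integral_nonneg fun x => le_max_left _ _)
  have hq0 : 0 ≤ q := hγ.trans hq
  have hint : ∀ (μ : Measure (E k)) [IsFiniteMeasure μ],
      Integrable (fun x => max 0 (c - |g x|)) μ := fun μ _ =>
    Integrable.of_bound (C := |c|) (by fun_prop) (ae_of_all _ fun x => by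
      rw [Real.norm_eq_abs, abs_of_nonneg (le_max_left _ _)]
      exact max_le (abs_nonneg _) (by linarith [le_abs_self c, abs_nonneg (g x)]))
  calc γ * (c - ∫ x, g x ∂ν) ≤ q * (c - ∫ x, g x ∂ν) := by gcongr
    _ = q * ∫ x, (c - g x) ∂ν := by
      rw [integral_sub (integrable_const _) hgi]; simp
    _ ≤ q * ∫ x, max 0 (c - |g x|) ∂ν := by
      refine mul_le_mul_of_nonneg_left (integral_mono ((integrable_const _).sub hgi) (hint ν)
        fun x => ?_) hq0
      simp only
      rw [abs_of_nonneg (hg0 x)]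
      exact le_max_right _ _
    _ = ∫ x, max 0 (c - |g x|) ∂(ENNReal.ofReal q • ν) := by
      rw [integral_smul_measure, ENNReal.toReal_ofReal hq0, smul_eq_mul]
    _ ≤ _ := integral_mono_measure hle (ae_of_all _ fun x => le_max_left _ _) (hint P)

/-! ### The law of a subsample -/

/-- The uniform distribution on a subsample. -/
def sampleLaw {n : ℕ} (x : Fin n → E k) (S : Finset (Fin n)) : Measure (E k) :=
  (S.card : ENNReal)⁻¹ • ∑ i ∈ S, Measure.dirac (x i)

section SampleLaw

variable {n : ℕ} (x : Fin n → E k) {S : Finset (Fin n)}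

theorem integrable_sampleLaw {F : Type*} [NormedAddCommGroup F] (hS : S.Nonempty) (f : E k → F) :
    Integrable f (sampleLaw x S) := by
  refine Integrable.smul_measure ?_ (by simp [hS.card_pos.ne'])
  exact integrable_finsetSum_measure.2 fun i _ => integrable_dirac (by simp)

theorem integral_sampleLaw {F : Type*} [NormedAddCommGroup F] [NormedSpace ℝ F] [CompleteSpace F]
    (f : E k → F) :
    ∫ y, f y ∂(sampleLaw x S) = (S.card : ℝ)⁻¹ • ∑ i ∈ S, f (x i) := by
  rw [sampleLaw, integral_smul_measure, integral_finsetSum_measure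
    fun i _ => integrable_dirac (by simp)]
  simp

theorem isProbabilityMeasure_sampleLaw (hS : S.Nonempty) :
    IsProbabilityMeasure (sampleLaw x S) := by
  constructor
  simp [sampleLaw, ENNReal.inv_mul_cancel, hS.card_pos.ne']

theorem memLp_sampleLaw (hS : S.Nonempty) : MemLp (fun y : E k => y) 2 (sampleLaw x S) :=
  (memLp_two_iff_integrable_sq_norm (by fun_prop)).2 (integrable_sampleLaw x hS _)

theorem meanOf_sampleLaw : meanOf (sampleLaw x S) = sampleMean x S :=
  integral_sampleLaw x _

theorem covOf_sampleLaw : covOf (sampleLaw x S) = sampleCov x S := by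
  ext i j
  simp [covOf, integral_sampleLaw, meanOf_sampleLaw, sampleCov, Matrix.sum_apply,
    Matrix.vecMulVec_apply]

theorem empiricalMeasure_eq_sampleLaw : empiricalMeasure x = sampleLaw x Finset.univ := by
  simp [empiricalMeasure, sampleLaw]

theorem isTrimmedLaw_sampleLaw {γ : ℝ} (hγ : 0 < γ) (hn : 1 ≤ n)
    (hS : ⌈(n : ℝ) * γ⌉₊ ≤ S.card) :
    S.Nonempty ∧ IsTrimmedLaw (empiricalMeasure x) γ (sampleLaw x S) := by
  have hn0 : (0 : ℝ) < n := by exact_mod_cast hn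
  have hc : (n : ℝ) * γ ≤ S.card := Nat.ceil_le.1 hS
  have hc0 : (0 : ℝ) < S.card := lt_of_lt_of_le (by positivity) hc
  have hne : S.Nonempty := Finset.card_pos.1 (by exact_mod_cast hc0)
  refine ⟨hne, isProbabilityMeasure_sampleLaw x hne, memLp_sampleLaw x hne,
    (S.card : ℝ) / n, by rwa [le_div_iff₀ hn0, mul_comm], ?_⟩
  have e : ENNReal.ofReal ((S.card : ℝ) / n) * (S.card : ENNReal)⁻¹ = (n : ENNReal)⁻¹ := by
    rw [ENNReal.ofReal_div_of_pos hn0, ENNReal.ofReal_natCast, ENNReal.ofReal_natCast,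
      div_eq_mul_inv, mul_comm, ← mul_assoc, ENNReal.inv_mul_cancel (by simp [hne.card_pos.ne'])
      (by simp), one_mul]
  rw [sampleLaw, smul_smul, e, empiricalMeasure]
  gcongr
  · exact fun i _ _ => Measure.zero_le _
  · exact Finset.subset_univ S

end SampleLaw

/-! ### The law of a trimming function -/

/-- The normalized measure with `P`-density proportional to `φ`. -/
def trimLaw (P : Measure (E k)) (φ : E k → ℝ) : Measure (E k) :=
  ENNReal.ofReal (∫ x, φ x ∂P)⁻¹ • P.withDensity fun x => ENNReal.ofReal (φ x)

section TrimLaw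

variable {P : Measure (E k)} {γ : ℝ} {φ : E k → ℝ}

theorem IsTrimming.integrable [IsFiniteMeasure P] (h : IsTrimming P γ φ) : Integrable φ P :=
  Integrable.of_bound (C := 1) h.measurable.aestronglyMeasurable (ae_of_all _ fun x => by
    rw [Real.norm_eq_abs, abs_of_nonneg (h.mem_Icc x).1]; exact (h.mem_Icc x).2)

theorem integral_trimLaw {F : Type*} [NormedAddCommGroup F] [NormedSpace ℝ F]
    (h : IsTrimming P γ φ) (f : E k → F) :
    ∫ y, f y ∂(trimLaw P φ) = (∫ x, φ x ∂P)⁻¹ • ∫ y, φ y • f y ∂P := by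
  have h0 : 0 ≤ ∫ x, φ x ∂P := integral_nonneg fun x => (h.mem_Icc x).1
  rw [trimLaw, integral_smul_measure, ENNReal.toReal_ofReal (by positivity),
    integral_withDensity_eq_integral_toReal_smul h.measurable.ennreal_ofReal (by simp)]
  simp_rw [ENNReal.toReal_ofReal (h.mem_Icc _).1]

theorem integrable_trimLaw_iff {F : Type*} [NormedAddCommGroup F] [NormedSpace ℝ F]
    (hγ : 0 < γ) (h : IsTrimming P γ φ) {f : E k → F} :
    Integrable f (trimLaw P φ) ↔ Integrable (fun y => φ y • f y) P := by
  have hpos : 0 < ∫ x, φ x ∂P := hγ.trans_le h.mass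
  rw [trimLaw, integrable_smul_measure (by simpa using hpos) (by simp),
    integrable_withDensity_iff_integrable_smul' h.measurable.ennreal_ofReal (by simp)]
  simp only [ENNReal.toReal_ofReal (h.mem_Icc _).1]

theorem isTrimmedLaw_trimLaw [IsFiniteMeasure P] (hγ : 0 < γ) (h : IsTrimming P γ φ) :
    IsTrimmedLaw P γ (trimLaw P φ) := by
  have hpos : 0 < ∫ x, φ x ∂P := hγ.trans_le h.mass
  refine ⟨⟨?_⟩, ?_, ∫ x, φ x ∂P, h.mass, ?_⟩
  · rw [trimLaw, Measure.smul_apply, withDensity_apply _ MeasurableSet.univ, Measure.restrict_univ,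
      ← ofReal_integral_eq_lintegral_ofReal h.integrable (ae_of_all _ fun x => (h.mem_Icc x).1),
      smul_eq_mul, ← ENNReal.ofReal_mul (by positivity), inv_mul_cancel₀ hpos.ne']
    simp
  · refine (memLp_two_iff_integrable_sq_norm (by fun_prop)).2 ((integrable_trimLaw_iff hγ h).2 ?_)
    simpa [mul_comm] using h.integrable_sq
  · rw [trimLaw, smul_smul, ← ENNReal.ofReal_mul hpos.le, mul_inv_cancel₀ hpos.ne',
      ENNReal.ofReal_one, one_smul]
    calc P.withDensity (fun x => ENNReal.ofReal (φ x)) ≤ P.withDensity 1 :=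
          withDensity_mono (ae_of_all _ fun x => by
            simpa using (h.mem_Icc x).2)
      _ = P := withDensity_one

theorem meanOf_trimLaw (h : IsTrimming P γ φ) : meanOf (trimLaw P φ) = trimmedMean P φ :=
  integral_trimLaw h _

theorem covOf_trimLaw (h : IsTrimming P γ φ) : covOf (trimLaw P φ) = trimmedCov P φ := by
  ext i j
  simp [covOf, integral_trimLaw h, meanOf_trimLaw h, trimmedCov, mul_comm]

end TrimLaw

/-! ### Weak convergence with a moving parameter -/

section Parameter

/-- A moving parameter becomes a second coordinate: with `ρ ⊗ δ_θ`, integrands and sets depending on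
`θ` become fixed ones on the product space. -/
theorem toMeasure_prod_diracProba {Y Θ : Type*} [MeasurableSpace Y] [MeasurableSpace Θ]
    (ρ : ProbabilityMeasure Y) (θ : Θ) :
    ((ρ.prod (diracProba θ) : ProbabilityMeasure (Y × Θ)) : Measure (Y × Θ)) =
      (ρ : Measure Y).map fun x => (x, θ) :=
  Measure.prod_dirac _

variable {Y Θ : Type*} [TopologicalSpace Y] [TopologicalSpace.PseudoMetrizableSpace Y]
  [SecondCountableTopology Y] [MeasurableSpace Y] [OpensMeasurableSpace Y]
  [TopologicalSpace Θ] [TopologicalSpace.PseudoMetrizableSpace Θ] [SecondCountableTopology Θ]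

theorem continuous_prod_diracProba [MeasurableSpace Θ] [OpensMeasurableSpace Θ] :
    Continuous fun p : ProbabilityMeasure Y × Θ => p.1.prod (diracProba p.2) :=
  ProbabilityMeasure.continuous_prod.comp
    (continuous_fst.prodMk (continuous_diracProba.comp continuous_snd))

theorem continuous_integral_param (G : BoundedContinuousFunction (Y × Θ) ℝ) :
    Continuous fun p : ProbabilityMeasure Y × Θ => ∫ x, G (x, p.2) ∂(p.1 : Measure Y) := by
  let _ : MeasurableSpace Θ := borel Θ
  have : BorelSpace Θ := ⟨rfl⟩
  have h := (ProbabilityMeasure.continuous_integral_boundedContinuousFunction G).comp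
    (continuous_prod_diracProba (Y := Y) (Θ := Θ))
  refine h.congr fun p => ?_
  simp only [Function.comp]
  rw [toMeasure_prod_diracProba, integral_map (by fun_prop) G.continuous.aestronglyMeasurable]

theorem continuous_integral_max (G : Y × Θ → ℝ) (hG : Continuous G) (c : ℝ) :
    Continuous fun p : ProbabilityMeasure Y × Θ =>
      ∫ x, max 0 (c - |G (x, p.2)|) ∂(p.1 : Measure Y) :=
  continuous_integral_param (BoundedContinuousFunction.ofNormedAddCommGroup
    (fun z => max 0 (c - |G z|)) (by fun_prop) |c| fun z => by
      rw [Real.norm_eq_abs, abs_of_nonneg (le_max_left _ _)]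
      exact max_le (abs_nonneg _) (by linarith [le_abs_self c, abs_nonneg (G z)]))

theorem eventually_lt_measureReal_of_isOpen {ι : Type*} {l : Filter ι}
    {ρ : ι → ProbabilityMeasure Y} {ρ₀ : ProbabilityMeasure Y} (hρ : Tendsto ρ l (𝓝 ρ₀))
    {θ : ι → Θ} {θ₀ : Θ} (hθ : Tendsto θ l (𝓝 θ₀)) {U : Set (Y × Θ)} (hU : IsOpen U) {r : ℝ}
    (hr0 : 0 ≤ r) (hr : r < (ρ₀ : Measure Y).real {x | (x, θ₀) ∈ U}) :
    ∀ᶠ i in l, r < (ρ i : Measure Y).real {x | (x, θ i) ∈ U} := by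
  let _ : MeasurableSpace Θ := borel Θ
  have : BorelSpace Θ := ⟨rfl⟩
  have h := (continuous_prod_diracProba (Y := Y) (Θ := Θ)).tendsto (ρ₀, θ₀) |>.comp
    (hρ.prodMk_nhds hθ)
  have e : ∀ (ρ : ProbabilityMeasure Y) (θ : Θ),
      ((ρ.prod (diracProba θ) : ProbabilityMeasure (Y × Θ)) : Measure (Y × Θ)) U =
        (ρ : Measure Y) {x | (x, θ) ∈ U} := fun ρ θ => by
    rw [toMeasure_prod_diracProba, Measure.map_apply (by fun_prop) hU.measurableSet]
    rfl
  have h1 := ProbabilityMeasure.le_liminf_measure_open_of_tendsto h hU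
  rw [e] at h1
  have h2 : ENNReal.ofReal r < (ρ₀ : Measure Y) {x | (x, θ₀) ∈ U} :=
    (ENNReal.ofReal_lt_iff_lt_toReal hr0 (measure_ne_top _ _)).2 hr
  filter_upwards [eventually_lt_of_lt_liminf (h2.trans_le h1)] with i hi
  simp only [Function.comp, e] at hi
  exact (ENNReal.ofReal_lt_iff_lt_toReal hr0 (measure_ne_top _ _)).1 hi

end Parameter

/-! ### Uniform nondegeneracy of trimmed laws -/

/-- As `j → ∞`, `(1 - (j + 1) u²)⁺` tends to the indicator of `u = 0`, an event of mass below `γ`.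
Rescaling gives `c = 1 / (j + 1)`. -/
theorem exists_integral_max_lt {P : Measure (E k)} [IsProbabilityMeasure P] {γ : ℝ} (hγ : 0 < γ)
    (hP : HyperplaneCondition P γ) (v : E k × ℝ) (hv : v ≠ 0) :
    ∃ c : ℝ, 0 < c ∧ ∫ x, max 0 (c - |(inner ℝ v.1 x - v.2) ^ 2|) ∂P < γ * c := by
  have hH : P.real {x | inner ℝ v.1 x = v.2} < γ := by
    by_cases ha : v.1 = 0
    · have hb : v.2 ≠ 0 := fun hb => hv (Prod.ext ha hb)
      simpa [ha, hb.symm] using hγ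
    · exact hP _ ha _
  have hmeas : MeasurableSet {x : E k | inner ℝ v.1 x = v.2} :=
    measurableSet_eq_fun (by fun_prop) (by fun_prop)
  have hlim : Tendsto (fun j : ℕ => ∫ x, max 0 (1 - ((j : ℝ) + 1) * (inner ℝ v.1 x - v.2) ^ 2) ∂P)
      atTop (𝓝 (∫ x, {x : E k | inner ℝ v.1 x = v.2}.indicator (fun _ => (1 : ℝ)) x ∂P)) := by
    refine tendsto_integral_of_dominated_convergence (fun _ => 1) (fun j => by fun_prop)
      (integrable_const _) (fun j => ae_of_all _ fun x => ?_) (ae_of_all _ fun x => ?_)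
    · rw [Real.norm_eq_abs, abs_of_nonneg (le_max_left _ _)]
      exact max_le zero_le_one (by linarith [show 0 ≤ ((j : ℝ) + 1) *
        (inner ℝ v.1 x - v.2) ^ 2 by positivity])
    · by_cases hx : inner ℝ v.1 x = v.2
      · simp [hx]
      · have hu : 0 < (inner ℝ v.1 x - v.2) ^ 2 := by
          have := sub_ne_zero.2 hx
          positivity
        rw [Set.indicator_of_notMem (by simpa using hx)]
        refine tendsto_const_nhds.congr' ?_
        filter_upwards [eventually_ge_atTop ⌈1 / (inner ℝ v.1 x - v.2) ^ 2⌉₊] with j hj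
        have := Nat.ceil_le.1 hj
        rw [div_le_iff₀ hu] at this
        rw [max_eq_left]
        nlinarith
  rw [integral_indicator_const _ hmeas, smul_eq_mul, mul_one] at hlim
  obtain ⟨j, hj⟩ := (hlim.eventually_lt_const hH).exists
  have hj0 : (0 : ℝ) < (j : ℝ) + 1 := by positivity
  refine ⟨((j : ℝ) + 1)⁻¹, by positivity, ?_⟩
  rw [← div_eq_mul_inv, lt_div_iff₀ hj0, ← integral_mul_const]
  refine lt_of_le_of_lt (le_of_eq (integral_congr_ae (ae_of_all _ fun x => ?_))) hj
  simp only
  rw [max_mul_of_nonneg _ _ hj0.le, zero_mul, abs_of_nonneg (sq_nonneg _), sub_mul,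
    inv_mul_cancel₀ hj0.ne']
  ring_nf

/-- If `∫ (c - g)⁺ dρ < d < γ c`, then `le_integral` gives `∫ g dν > c - d / γ > 0`. The first
inequality is open in the law and in `(a, b)`, so compactness of the unit sphere makes the bound
uniform, and homogeneity extends it. Including `b` also controls the mean. -/
theorem exists_eventually_le_integral_sq (P : ProbabilityMeasure (E k)) {γ : ℝ} (hγ : 0 < γ)
    (hP : HyperplaneCondition (P : Measure (E k)) γ) :
    ∃ l : ℝ, 0 < l ∧ ∀ᶠ ρ : ProbabilityMeasure (E k) in 𝓝 P, ∀ ν,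
      IsTrimmedLaw (ρ : Measure (E k)) γ ν → ∀ (a : E k) (b : ℝ),
        l * (‖a‖ ^ 2 + b ^ 2) ≤ ∫ x, (inner ℝ a x - b) ^ 2 ∂ν := by
  set K : Set (E k × ℝ) := {v | ‖v.1‖ ^ 2 + v.2 ^ 2 = 1} with hKdef
  have hK : IsCompact K := by
    refine Metric.isCompact_of_isClosed_isBounded
      (isClosed_eq (by fun_prop) (by fun_prop)) ?_
    refine Metric.isBounded_closedBall (x := (0 : E k × ℝ)) (r := 1) |>.subset fun v hv => ?_
    simp only [hKdef, Set.mem_ofPred_eq] at hv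
    rw [mem_closedBall_zero_iff, Prod.norm_def, max_le_iff, Real.norm_eq_abs]
    constructor
    · nlinarith [norm_nonneg v.1, sq_nonneg v.2]
    · rw [abs_le]; constructor <;> nlinarith [sq_nonneg ‖v.1‖]
  have key : ∃ l : ℝ, 0 < l ∧ ∀ᶠ ρ : ProbabilityMeasure (E k) in 𝓝 P, ∀ v ∈ K, ∀ ν,
      IsTrimmedLaw (ρ : Measure (E k)) γ ν → l ≤ ∫ x, (inner ℝ v.1 x - v.2) ^ 2 ∂ν := by
    refine hK.induction_on ⟨1, one_pos, by simp⟩ ?_ ?_ ?_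
    · rintro s t hst ⟨l, hl, h⟩
      exact ⟨l, hl, h.mono fun ρ hρ v hv => hρ v (hst hv)⟩
    · rintro s t ⟨l, hl, h⟩ ⟨l', hl', h'⟩
      refine ⟨min l l', lt_min hl hl', ?_⟩
      filter_upwards [h, h'] with ρ hρ hρ' v hv ν hν
      rcases hv with hv | hv
      · exact (min_le_left _ _).trans (hρ v hv ν hν)
      · exact (min_le_right _ _).trans (hρ' v hv ν hν)
    · intro v hv
      have hv0 : v ≠ 0 := by
        rintro rfl
        simp [hKdef] at hv
      obtain ⟨c, hc, hlt⟩ := exists_integral_max_lt hγ hP v hv0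
      obtain ⟨d, hd1, hd2⟩ := exists_between hlt
      have hcont := continuous_integral_max (Y := E k) (Θ := E k × ℝ)
        (fun z => (inner ℝ z.2.1 z.1 - z.2.2) ^ 2) (by fun_prop) c
      have hev := (hcont.tendsto (P, v)).eventually_lt_const hd1
      rw [nhds_prod_eq] at hev
      obtain ⟨p, hp, q, hq, hpq⟩ := eventually_prod_iff.1 hev
      refine ⟨{w | q w}, mem_nhdsWithin_of_mem_nhds hq, c - d / γ, ?_, ?_⟩
      · rw [sub_pos, div_lt_iff₀ hγ, mul_comm]
        exact hd2
      · filter_upwards [hp] with ρ hρ w hw ν hν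
        have := hν.prob
        have hint : Integrable (fun x : E k => (inner ℝ w.1 x - w.2) ^ 2) ν :=
          ((hν.memLp.const_inner w.1).sub (memLp_const w.2)).integrable_sq
        have h1 := hν.le_integral hγ.le (by fun_prop) (fun x => sq_nonneg _) hint c
        have h2 := h1.trans_lt (hpq hρ hw)
        rw [mul_comm, ← lt_div_iff₀ hγ] at h2
        linarith
  obtain ⟨l, hl, h⟩ := key
  refine ⟨l, hl, h.mono fun ρ hρ ν hν a b => ?_⟩
  rcases eq_or_ne (‖a‖ ^ 2 + b ^ 2) 0 with h0 | h0
  · rw [h0, mul_zero]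
    exact integral_nonneg fun x => sq_nonneg _
  · have hpos : 0 < ‖a‖ ^ 2 + b ^ 2 := lt_of_le_of_ne (by positivity) h0.symm
    set r := Real.sqrt (‖a‖ ^ 2 + b ^ 2)
    have hr : 0 < r := Real.sqrt_pos.2 hpos
    have hr2 : r ^ 2 = ‖a‖ ^ 2 + b ^ 2 := Real.sq_sqrt hpos.le
    have h1 := hρ (r⁻¹ • a, r⁻¹ * b) (by
      simp only [hKdef, Set.mem_ofPred_eq, norm_smul, mul_pow, norm_inv, Real.norm_eq_abs,
        abs_of_pos hr]
      rw [← mul_add, ← hr2]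
      field_simp) ν hν
    have e : ∀ x : E k, (inner ℝ (r⁻¹ • a) x - r⁻¹ * b) ^ 2 = (inner ℝ a x - b) ^ 2 / r ^ 2 :=
      fun x => by rw [real_inner_smul_left]; field_simp
    simp only [e] at h1
    rw [integral_div, le_div_iff₀ (by positivity), hr2] at h1
    exact h1

/-! ### Trimming at a quantile -/

theorem exists_quantile {α : Type*} [MeasurableSpace α] {P : Measure α} [IsProbabilityMeasure P]
    {γ : ℝ} (hγ : 0 < γ) {g : α → ℝ} (hg : Measurable g) (hg0 : ∀ x, 0 ≤ g x)
    (h : ∃ c, γ ≤ P.real {x | g x ≤ c}) :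
    ∃ c, 0 ≤ c ∧ γ ≤ P.real {x | g x ≤ c} ∧ P.real {x | g x < c} ≤ γ := by
  set A : Set ℝ := {c | γ ≤ P.real {x | g x ≤ c}} with hA
  have hA0 : ∀ c ∈ A, 0 ≤ c := fun c hc => by
    by_contra! hlt
    have : {x | g x ≤ c} = ∅ := by
      ext x
      simpa using hlt.trans_le (hg0 x)
    simp only [hA, Set.mem_ofPred_eq, this, measureReal_empty] at hc
    linarith
  have hbdd : BddBelow A := ⟨0, hA0⟩
  have hup : ∀ c, sInf A < c → γ ≤ P.real {x | g x ≤ c} := fun c hc => by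
    obtain ⟨d, hd, hdc⟩ := exists_lt_of_csInf_lt h hc
    exact le_trans hd (measureReal_mono fun x (hx : g x ≤ d) => hx.trans hdc.le)
  refine ⟨sInf A, le_csInf h hA0, ?_, ?_⟩
  · have hanti : Antitone fun n : ℕ => {x | g x ≤ sInf A + 1 / ((n : ℝ) + 1)} :=
      fun i j hij x hx => le_trans (b := sInf A + 1 / ((j : ℝ) + 1)) hx (by gcongr)
    have e : {x | g x ≤ sInf A} = ⋂ n : ℕ, {x | g x ≤ sInf A + 1 / ((n : ℝ) + 1)} := by
      ext x
      simp only [Set.mem_iInter, Set.mem_ofPred_eq]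
      refine ⟨fun hx n => hx.trans (by simp; positivity), fun hx => ?_⟩
      have := tendsto_one_div_add_atTop_nhds_zero_nat (𝕜 := ℝ) |>.const_add (sInf A)
      rw [add_zero] at this
      exact ge_of_tendsto' this hx
    have ht := tendsto_measure_iInter_atTop (μ := P)
      (fun n => (measurableSet_le hg measurable_const).nullMeasurableSet) hanti
      ⟨0, measure_ne_top _ _⟩
    rw [← e] at ht
    exact ge_of_tendsto' ((ENNReal.tendsto_toReal (measure_ne_top _ _)).comp ht)
      fun n => hup _ (by simp; positivity)
  · have hmono : Monotone fun n : ℕ => {x | g x ≤ sInf A - 1 / ((n : ℝ) + 1)} :=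
      fun i j hij x hx => le_trans (b := sInf A - 1 / ((i : ℝ) + 1)) hx (by gcongr)
    have e : {x | g x < sInf A} = ⋃ n : ℕ, {x | g x ≤ sInf A - 1 / ((n : ℝ) + 1)} := by
      ext x
      simp only [Set.mem_iUnion, Set.mem_ofPred_eq]
      refine ⟨fun hx => ?_, fun ⟨n, hx⟩ => hx.trans_lt (by simp; positivity)⟩
      obtain ⟨n, hn⟩ := exists_nat_one_div_lt (sub_pos.2 hx)
      exact ⟨n, by linarith⟩
    have ht := tendsto_measure_iUnion_atTop (μ := P) hmono
    rw [← e] at ht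
    refine le_of_tendsto' ((ENNReal.tendsto_toReal (measure_ne_top _ _)).comp ht) fun n => ?_
    have : sInf A - 1 / ((n : ℝ) + 1) ∉ A :=
      notMem_of_lt_csInf (by simp; positivity) hbdd
    exact (not_le.1 this).le

/-- Since `c - (c - g)⁺ = min c g`, the hypothesis bounds the truncated integrals by `κ`, and
monotone convergence removes the truncation. -/
theorem integrable_of_le_integral_max {α : Type*} [MeasurableSpace α] {P : Measure α}
    [IsProbabilityMeasure P] {g : α → ℝ} (hg : Measurable g) (hg0 : ∀ x, 0 ≤ g x) {κ : ℝ}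
    (h : ∀ c, c - κ ≤ ∫ x, max 0 (c - |g x|) ∂P) :
    Integrable g P ∧ ∫ x, g x ∂P ≤ κ := by
  have hint : ∀ n : ℕ, Integrable (fun x => min (n : ℝ) (g x)) P := fun n =>
    Integrable.of_bound (C := n) (by fun_prop) (ae_of_all _ fun x => by
      rw [Real.norm_eq_abs, abs_of_nonneg (le_min n.cast_nonneg (hg0 x))]
      exact min_le_left _ _)
  have hle : ∀ n : ℕ, ∫ x, min (n : ℝ) (g x) ∂P ≤ κ := fun n => by
    have h1 := h n
    have e : ∀ x, max 0 ((n : ℝ) - |g x|) = n - min (n : ℝ) (g x) := fun x => by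
      rw [abs_of_nonneg (hg0 x)]
      rcases le_total (n : ℝ) (g x) with h | h
      · rw [min_eq_left h, max_eq_left (by linarith)]; ring
      · rw [min_eq_right h, max_eq_right (by linarith)]
    simp only [e] at h1
    rw [integral_sub (integrable_const _) (hint n)] at h1
    simp only [integral_const, probReal_univ, one_smul] at h1
    linarith
  have hκ : 0 ≤ κ := (integral_nonneg fun x => le_min (by simp) (hg0 x)).trans (hle 0)
  have hlim : Tendsto (fun n : ℕ => ∫⁻ x, ENNReal.ofReal (min (n : ℝ) (g x)) ∂P) atTop
      (𝓝 (∫⁻ x, ENNReal.ofReal (g x) ∂P)) := by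
    refine lintegral_tendsto_of_tendsto_of_monotone (fun n => by fun_prop)
      (ae_of_all _ fun x i j hij => ENNReal.ofReal_le_ofReal (by gcongr))
      (ae_of_all _ fun x => ?_)
    refine tendsto_const_nhds.congr' ?_
    filter_upwards [eventually_ge_atTop ⌈g x⌉₊] with n hn
    rw [min_eq_right (Nat.ceil_le.1 hn)]
  have hL : ∫⁻ x, ENNReal.ofReal (g x) ∂P ≤ ENNReal.ofReal κ := by
    refine le_of_tendsto' hlim fun n => ?_
    rw [← ofReal_integral_eq_lintegral_ofReal (hint n)
      (ae_of_all _ fun x => le_min n.cast_nonneg (hg0 x))]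
    exact ENNReal.ofReal_le_ofReal (hle n)
  have hi : Integrable g P :=
    (lintegral_ofReal_ne_top_iff_integrable hg.aestronglyMeasurable (ae_of_all _ hg0)).1
      (ne_top_of_le_ne_top ENNReal.ofReal_ne_top hL)
  refine ⟨hi, ?_⟩
  rw [integral_eq_lintegral_of_nonneg_ae (ae_of_all _ hg0) hg.aestronglyMeasurable]
  exact ENNReal.toReal_le_of_le_ofReal hκ hL

/-- Converse of `le_integral`. Trimming at a `γ`-quantile `c` of `g`, with a constant weight on the
level set `g = c`, gives mass exactly `γ` and `(c - g)⁺ = φ (c - g)`. The hypothesis at this single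
`c` is then the claim. -/
theorem exists_trimming_integral_le {α : Type*} [MeasurableSpace α] {P : Measure α}
    [IsProbabilityMeasure P] {γ : ℝ} (hγ : 0 < γ) {g : α → ℝ} (hg : Measurable g)
    (hg0 : ∀ x, 0 ≤ g x) {κ : ℝ} (h : ∀ c, γ * (c - κ) ≤ ∫ x, max 0 (c - |g x|) ∂P)
    (hγ1 : γ ≤ 1) :
    ∃ φ : α → ℝ, Measurable φ ∧ (∀ x, φ x ∈ Set.Icc (0 : ℝ) 1) ∧ γ ≤ ∫ x, φ x ∂P ∧
      Integrable (fun x => φ x * g x) P ∧ ∫ x, φ x * g x ∂P ≤ κ * ∫ x, φ x ∂P := by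
  by_cases hq : ∃ c, γ ≤ P.real {x | g x ≤ c}
  · obtain ⟨c, hc0, hc1, hc2⟩ := exists_quantile hγ hg hg0 hq
    set p := P.real {x | g x < c}
    set q := P.real {x | g x = c} with hqdef
    have hm1 : MeasurableSet {x | g x < c} := measurableSet_lt hg measurable_const
    have hm2 : MeasurableSet {x | g x = c} := measurableSet_eq_fun hg measurable_const
    have hpq : γ ≤ p + q := by
      refine hc1.trans (le_of_le_of_eq (measureReal_mono fun x (hx : g x ≤ c) => ?_)
        (measureReal_union (Set.disjoint_left.2 fun x (hx : g x < c) => hx.ne) hm2))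
      exact lt_or_eq_of_le hx
    have hq0 : 0 ≤ q := measureReal_nonneg
    -- If `q = 0`, the convention `θ = 0` is right, because then `p = γ`.
    set θ := (γ - p) / q
    have hθ0 : 0 ≤ θ := div_nonneg (by linarith) hq0
    have hθ1 : θ ≤ 1 := div_le_one_of_le₀ (by linarith) hq0
    have hθq : θ * q = γ - p := by
      rcases eq_or_ne q 0 with h0 | h0
      · rw [h0] at hpq ⊢; linarith
      · exact div_mul_cancel₀ _ h0
    set φ : α → ℝ := fun x =>
      {x | g x < c}.indicator (fun _ => (1 : ℝ)) x + {x | g x = c}.indicator (fun _ => θ) x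
    have hφlt : ∀ x, g x < c → φ x = 1 := fun x hx => by simp [φ, hx, hx.ne]
    have hφeq : ∀ x, g x = c → φ x = θ := fun x hx => by simp [φ, hx]
    have hφgt : ∀ x, c < g x → φ x = 0 := fun x hx => by simp [φ, hx.le, hx.ne']
    have hφm : Measurable φ :=
      (measurable_const.indicator hm1).add (measurable_const.indicator hm2)
    have hφI : ∀ x, φ x ∈ Set.Icc (0 : ℝ) 1 := fun x => by
      rcases lt_trichotomy (g x) c with hx | hx | hx
      · simp [hφlt x hx]
      · rw [hφeq x hx]; exact ⟨hθ0, hθ1⟩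
      · simp [hφgt x hx]
    have hφint : ∫ x, φ x ∂P = γ := by
      rw [integral_add ((integrable_const _).indicator hm1) ((integrable_const _).indicator hm2),
        integral_indicator_const _ hm1, integral_indicator_const _ hm2]
      simp only [smul_eq_mul]
      change p * 1 + q * θ = γ
      linarith
    have hφi : Integrable φ P :=
      Integrable.of_bound (C := 1) hφm.aestronglyMeasurable (ae_of_all _ fun x => by
        rw [Real.norm_eq_abs, abs_of_nonneg (hφI x).1]; exact (hφI x).2)
    have hφg : Integrable (fun x => φ x * g x) P :=
      Integrable.of_bound (C := c) (hφm.mul hg).aestronglyMeasurable (ae_of_all _ fun x => by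
        rw [Real.norm_eq_abs, abs_of_nonneg (mul_nonneg (hφI x).1 (hg0 x))]
        rcases le_or_gt (g x) c with hx | hx
        · exact (mul_le_of_le_one_left (hg0 x) (hφI x).2).trans hx
        · rw [hφgt x hx]; simpa using hc0)
    refine ⟨φ, hφm, hφI, hφint.ge, hφg, ?_⟩
    have h1 := h c
    have e : ∀ x, max 0 (c - |g x|) = c * φ x - φ x * g x := fun x => by
      rw [abs_of_nonneg (hg0 x)]
      rcases lt_trichotomy (g x) c with hx | hx | hx
      · rw [hφlt x hx, max_eq_right (by linarith)]; ring
      · rw [hx, hφeq x hx, sub_self, max_self]; ring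
      · rw [hφgt x hx, max_eq_left (by linarith)]; ring
    simp only [e] at h1
    rw [integral_sub (hφi.const_mul c) hφg, integral_const_mul, hφint] at h1
    rw [hφint]
    linarith
  -- Without a quantile all sublevel sets have mass below `γ` while exhausting the space, so `γ = 1`
  -- and `φ = 1` is the only natural choice.
  · push Not at hq
    have hγ1' : γ = 1 := by
      refine le_antisymm hγ1 ?_
      have ht := tendsto_measure_iUnion_atTop (μ := P) (s := fun n : ℕ => {x | g x ≤ n})
        fun i j hij x hx => le_trans (b := (i : ℝ)) hx (by exact_mod_cast hij)
      have e : ⋃ n : ℕ, {x | g x ≤ n} = Set.univ :=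
        Set.eq_univ_of_forall fun x => Set.mem_iUnion.2 ⟨⌈g x⌉₊, by simpa using Nat.le_ceil (g x)⟩
      rw [e] at ht
      have := (ENNReal.tendsto_toReal (measure_ne_top P _)).comp ht
      rw [measure_univ, ENNReal.toReal_one] at this
      exact le_of_tendsto' this fun n => (hq n).le
    obtain ⟨hi, hle⟩ := integrable_of_le_integral_max hg hg0 (κ := κ) (P := P)
      (by simpa [hγ1'] using h)
    exact ⟨fun _ => 1, measurable_const, fun _ => by simp, by simpa using hγ1, by simpa using hi,
      by simpa using hle⟩

/-! ### Enlarging a trimming function -/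

/-- A trimming function of mass exactly `γ` need not give sample sums reaching `⌈nγ⌉`. A small
multiple of `1 - φ`, restricted to a set where `g` is bounded, adds mass at little cost. At full
mass one takes `w = 1`, whose sample sum is exactly `n`. -/
theorem exists_weight {α : Type*} [MeasurableSpace α] {P : Measure α} [IsProbabilityMeasure P]
    {φ g : α → ℝ} (hφ : Measurable φ) (hφI : ∀ x, φ x ∈ Set.Icc (0 : ℝ) 1)
    (hφpos : 0 < ∫ x, φ x ∂P) (hg : Measurable g) (hg0 : ∀ x, 0 ≤ g x)
    (hφg : Integrable (fun x => φ x * g x) P) {κ κ' : ℝ}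
    (hκ : ∫ x, φ x * g x ∂P ≤ κ * ∫ x, φ x ∂P) (hκ' : κ < κ') :
    ∃ w : α → ℝ, Measurable w ∧ (∀ x, w x ∈ Set.Icc (0 : ℝ) 1) ∧
      Integrable (fun x => w x * g x) P ∧ ∫ x, w x * g x ∂P < κ' * ∫ x, w x ∂P ∧
      (∫ x, φ x ∂P < ∫ x, w x ∂P ∨ ∀ x, w x = 1) := by
  have hbdd : ∀ {f : α → ℝ}, Measurable f → (∀ x, f x ∈ Set.Icc (0 : ℝ) 1) → Integrable f P :=
    fun hf h => Integrable.of_bound (C := 1) hf.aestronglyMeasurable (ae_of_all _ fun x => by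
      rw [Real.norm_eq_abs, abs_of_nonneg (h x).1]; exact (h x).2)
  have hφi := hbdd hφ hφI
  have hA : ∫ x, φ x * g x ∂P < κ' * ∫ x, φ x ∂P := hκ.trans_lt (by gcongr)
  have hcompl : ∫ x, (1 - φ x) ∂P = 1 - ∫ x, φ x ∂P := by
    rw [integral_sub (integrable_const _) hφi]; simp
  rcases eq_or_ne (∫ x, φ x ∂P) 1 with h1 | h1
  · have h0 : ∫ x, (1 - φ x) ∂P = 0 := by rw [hcompl, h1, sub_self]
    rw [integral_eq_zero_iff_of_nonneg (fun x => sub_nonneg.2 (hφI x).2)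
      ((integrable_const _).sub hφi)] at h0
    have hae : ∀ᵐ x ∂P, φ x * g x = 1 * g x := by
      filter_upwards [h0] with x hx
      have : φ x = 1 := by simp at hx; linarith
      rw [this]
    refine ⟨fun _ => 1, measurable_const, fun _ => by simp, hφg.congr hae, ?_, Or.inr fun _ => rfl⟩
    rw [← integral_congr_ae hae]
    simpa [h1] using hA
  · have hlt : 0 < 1 - ∫ x, φ x ∂P := by
      have : ∫ x, φ x ∂P ≤ 1 := by
        have := integral_mono hφi (integrable_const 1) fun x => (hφI x).2
        simpa using this
      exact sub_pos.2 (lt_of_le_of_ne this h1)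
    have hms : ∀ n : ℕ, MeasurableSet {x | g x ≤ n} := fun n =>
      measurableSet_le hg measurable_const
    set ψ : ℕ → α → ℝ := fun n x => {x | g x ≤ n}.indicator (fun x => 1 - φ x) x
    have hψm : ∀ n, Measurable (ψ n) := fun n => (measurable_const.sub hφ).indicator (hms n)
    have hψI : ∀ n x, ψ n x ∈ Set.Icc (0 : ℝ) (1 - φ x) := fun n x => by
      have := sub_nonneg.2 (hφI x).2
      by_cases hx : g x ≤ n <;> simp [ψ, hx, this]
    have hlim : Tendsto (fun n => ∫ x, ψ n x ∂P) atTop (𝓝 (∫ x, (1 - φ x) ∂P)) := by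
      refine tendsto_integral_of_dominated_convergence (fun _ => 1)
        (fun n => (hψm n).aestronglyMeasurable)
        (integrable_const _) (fun n => ae_of_all _ fun x => ?_) (ae_of_all _ fun x => ?_)
      · rw [Real.norm_eq_abs, abs_of_nonneg (hψI n x).1]
        linarith [(hψI n x).2, (hφI x).1]
      · refine tendsto_const_nhds.congr' ?_
        filter_upwards [eventually_ge_atTop ⌈g x⌉₊] with n hn
        have : g x ≤ n := Nat.ceil_le.1 hn
        simp [ψ, this]
    rw [hcompl] at hlim
    obtain ⟨n, hn⟩ := (hlim.eventually_const_lt hlt).exists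
    have hψi : Integrable (ψ n) P := hbdd (hψm n) fun x =>
      ⟨(hψI n x).1, by linarith [(hψI n x).2, (hφI x).1]⟩
    have hψg : Integrable (fun x => ψ n x * g x) P :=
      Integrable.of_bound (C := n) ((hψm n).mul hg).aestronglyMeasurable (ae_of_all _ fun x => by
        rw [Real.norm_eq_abs, abs_of_nonneg (mul_nonneg (hψI n x).1 (hg0 x))]
        by_cases hx : g x ≤ n
        · exact (mul_le_of_le_one_left (hg0 x)
            (by linarith [(hψI n x).2, (hφI x).1])).trans hx
        · simp [ψ, hx])
    have hcont : Tendsto (fun η : ℝ => κ' * (∫ x, φ x ∂P + η * ∫ x, ψ n x ∂P) -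
        (∫ x, φ x * g x ∂P + η * ∫ x, ψ n x * g x ∂P)) (𝓝[>] 0)
        (𝓝 (κ' * (∫ x, φ x ∂P + 0 * ∫ x, ψ n x ∂P) -
        (∫ x, φ x * g x ∂P + 0 * ∫ x, ψ n x * g x ∂P))) := by
      refine Tendsto.mono_left (Continuous.tendsto ?_ 0) nhdsWithin_le_nhds
      fun_prop
    obtain ⟨η, hη, hη0, hη1⟩ := ((hcont.eventually_const_lt (u := 0) (by simpa using hA)).and
      (Ioo_mem_nhdsGT one_pos)).exists
    have e1 : ∫ x, (φ x + η * ψ n x) ∂P = ∫ x, φ x ∂P + η * ∫ x, ψ n x ∂P := by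
      rw [integral_add hφi (hψi.const_mul η), integral_const_mul]
    have e2 : ∀ x, (φ x + η * ψ n x) * g x = φ x * g x + η * (ψ n x * g x) := fun x => by ring
    refine ⟨fun x => φ x + η * ψ n x, hφ.add ((hψm n).const_mul η), fun x => ?_, ?_, ?_, Or.inl ?_⟩
    · have h2 := hψI n x
      have h3 := hφI x
      have h4 := mul_nonneg hη0.le h2.1
      have h5 := mul_le_of_le_one_left h2.1 hη1.le
      exact ⟨by linarith [h3.1], by linarith [h2.2]⟩
    · simp only [e2]
      exact hφg.add (hψg.const_mul η)
    · simp only [e2]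
      rw [integral_add hφg (hψg.const_mul η), integral_const_mul, e1]
      linarith
    · rw [e1]
      have := mul_pos hη0 hn
      linarith

/-! ### The subsample with the smallest values -/

/-- Fractional weights do not beat subsets: by exchange, a sum-minimizing `S` consists of lowest
values. With `c` the largest value on `S`, the total of `w (c - g)` is at most that of `c - g` over
`S`. -/
theorem exists_lowest_subset {ι : Type*} [Fintype ι] [DecidableEq ι] (g : ι → ℝ) {h : ℕ}
    (h0 : 0 < h) (hle : h ≤ Fintype.card ι) :
    ∃ S : Finset ι, S.card = h ∧ ∀ w : ι → ℝ, (∀ i, w i ∈ Set.Icc (0 : ℝ) 1) →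
      (h : ℝ) ≤ ∑ i, w i → (∑ i ∈ S, g i) * ∑ i, w i ≤ h * ∑ i, w i * g i := by
  obtain ⟨S, hS, hmin⟩ := Finset.exists_min_image (Finset.univ.powersetCard h)
    (fun S => ∑ i ∈ S, g i) (Finset.powersetCard_nonempty.2 hle)
  have hcard : S.card = h := (Finset.mem_powersetCard.1 hS).2
  have hlow : ∀ i ∈ S, ∀ j ∉ S, g i ≤ g j := fun i hi j hj => by
    have hj' : j ∉ S.erase i := fun hh => hj (Finset.mem_of_mem_erase hh)
    have h1 := hmin (insert j (S.erase i)) (Finset.mem_powersetCard.2 ⟨Finset.subset_univ _, by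
      rw [Finset.card_insert_of_notMem hj', Finset.card_erase_of_mem hi, hcard]; omega⟩)
    rw [Finset.sum_insert hj', ← Finset.add_sum_erase S g hi] at h1
    linarith
  refine ⟨S, hcard, fun w hw hsum => ?_⟩
  obtain ⟨i₀, hi₀, hmax⟩ := Finset.exists_max_image S g (Finset.card_pos.1 (hcard ▸ h0))
  set c := g i₀
  have h1 : ∑ i, w i * (c - g i) ≤ ∑ i ∈ S, (c - g i) := by
    rw [← Finset.sum_filter_add_sum_filter_not Finset.univ (· ∈ S)]
    have e : Finset.univ.filter (· ∈ S) = S := by ext; simp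
    rw [e, ← add_zero (∑ i ∈ S, (c - g i))]
    refine add_le_add (Finset.sum_le_sum fun i hi => ?_) (Finset.sum_nonpos fun i hi => ?_)
    · exact mul_le_of_le_one_left (sub_nonneg.2 (hmax i hi)) (hw i).2
    · exact mul_nonpos_of_nonneg_of_nonpos (hw i).1
        (sub_nonpos.2 (hlow _ hi₀ i (by simpa using hi)))
  have h2 : ∑ i ∈ S, g i ≤ h * c := by
    rw [← hcard, ← nsmul_eq_mul]
    exact Finset.sum_le_card_nsmul _ _ _ hmax
  simp only [mul_sub, Finset.sum_sub_distrib, ← Finset.sum_mul, Finset.sum_const, hcard,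
    nsmul_eq_mul] at h1
  -- Add `(h c - ∑_S g) (∑ w - h) ≥ 0` to `h` times the inequality `h1`.
  nlinarith [mul_nonneg (sub_nonneg.2 h2) (sub_nonneg.2 hsum),
    mul_nonneg (Nat.cast_nonneg (α := ℝ) h) (sub_nonneg.2 h1)]

/-! ### Almost sure convergence of empirical measures -/

theorem isProbabilityMeasure_empiricalMeasure {n : ℕ} (hn : 1 ≤ n) (x : Fin n → E k) :
    IsProbabilityMeasure (empiricalMeasure x) := by
  rw [empiricalMeasure_eq_sampleLaw]
  exact isProbabilityMeasure_sampleLaw x ⟨⟨0, hn⟩, Finset.mem_univ _⟩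

/-- The empirical measure of the first `n` points of a sequence, as a probability measure. -/
def empiricalLaw (x : ℕ → E k) (n : ℕ) : ProbabilityMeasure (E k) :=
  if h : 1 ≤ n then
    ⟨empiricalMeasure fun i : Fin n => x i, isProbabilityMeasure_empiricalMeasure h _⟩
  -- An arbitrary law: the empirical measure of no points is zero.
  else diracProba 0

theorem toMeasure_empiricalLaw (x : ℕ → E k) {n : ℕ} (hn : 1 ≤ n) :
    (empiricalLaw x n : Measure (E k)) = empiricalMeasure fun i : Fin n => x i := by
  have : empiricalLaw x n = ⟨_, isProbabilityMeasure_empiricalMeasure hn _⟩ := dif_pos hn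
  rw [this]
  rfl

section AlmostSure

variable {Ω : Type*} [MeasurableSpace Ω] {μ : Measure Ω} {P₀ : Measure (E k)} {X : ℕ → Ω → E k}

theorem ae_tendsto_average (hXlaw : ∀ i, HasLaw (X i) P₀ μ) (hXindep : iIndepFun X μ)
    {f : E k → ℝ} (hf : Measurable f) (hfi : Integrable f P₀) :
    ∀ᵐ ω ∂μ, Tendsto (fun n : ℕ => (∑ i : Fin n, f (X i ω)) / n) atTop (𝓝 (∫ x, f x ∂P₀)) := by
  have hid : ∀ i, IdentDistrib (X i) (X 0) μ μ := fun i =>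
    ⟨(hXlaw i).aemeasurable, (hXlaw 0).aemeasurable, by rw [(hXlaw i).map_eq, (hXlaw 0).map_eq]⟩
  have hint : Integrable (f ∘ X 0) μ := by
    refine Integrable.comp_aemeasurable ?_ (hXlaw 0).aemeasurable
    rwa [(hXlaw 0).map_eq]
  have := strong_law_ae_real (fun i => f ∘ X i) hint
    (fun i j hij => (hXindep.indepFun hij).comp hf hf) fun i => (hid i).comp hf
  have e : μ[f ∘ X 0] = ∫ x, f x ∂P₀ := (hXlaw 0).integral_comp hf.aestronglyMeasurable
  rw [e] at this
  filter_upwards [this] with ω hω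
  refine hω.congr fun n => ?_
  rw [Finset.sum_range]
  rfl

theorem ae_tendsto_empiricalLaw [IsProbabilityMeasure P₀] (hXlaw : ∀ i, HasLaw (X i) P₀ μ) (hXindep : iIndepFun X μ) :
    ∀ᵐ ω ∂μ, Tendsto (empiricalLaw fun i => X i ω) atTop
      (𝓝 (⟨P₀, inferInstance⟩ : ProbabilityMeasure (E k))) := by
  set B := TopologicalSpace.countableBasis (E k)
  -- Finite intersections of a countable basis form a countable π-system that determines weak
  -- convergence, so a single null set suffices for the strong law.
  set A : Set (Set (E k)) := (fun F => ⋂₀ F) '' {F : Set (Set (E k)) | F.Finite ∧ F ⊆ B} with hA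
  have hAc : A.Countable :=
    (Set.countable_ofPred_finite_subset (TopologicalSpace.countable_countableBasis _)).image _
  have hAm : ∀ s ∈ A, MeasurableSet s := by
    rintro _ ⟨F, ⟨hF, hFB⟩, rfl⟩
    exact (hF.isOpen_sInter fun s hs =>
      TopologicalSpace.isOpen_of_mem_countableBasis (hFB hs)).measurableSet
  have hApi : IsPiSystem A := by
    rintro _ ⟨F, ⟨hF, hFB⟩, rfl⟩ _ ⟨G, ⟨hG, hGB⟩, rfl⟩ -
    exact ⟨F ∪ G, ⟨hF.union hG, Set.union_subset hFB hGB⟩, Set.sInter_union _ _⟩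
  have hAn : ∀ u : Set (E k), IsOpen u → ∀ x ∈ u, ∃ s ∈ A, s ∈ 𝓝 x ∧ s ⊆ u := by
    intro u hu x hx
    obtain ⟨v, hv, hxv, hvu⟩ :=
      (TopologicalSpace.isBasis_countableBasis (E k)).exists_subset_of_mem_open hx hu
    exact ⟨v, ⟨{v}, ⟨Set.finite_singleton v, by simpa using hv⟩, by simp⟩,
      (TopologicalSpace.isOpen_of_mem_countableBasis hv).mem_nhds hxv, hvu⟩
  have hae : ∀ᵐ ω ∂μ, ∀ s ∈ A, Tendsto (fun n : ℕ =>
      (∑ i : Fin n, s.indicator (fun _ => (1 : ℝ)) (X i ω)) / n) atTop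
        (𝓝 (∫ x, s.indicator (fun _ => (1 : ℝ)) x ∂P₀)) :=
    (ae_ball_iff hAc).2 fun s hs => ae_tendsto_average hXlaw hXindep
      (measurable_const.indicator (hAm s hs)) ((integrable_const _).indicator (hAm s hs))
  filter_upwards [hae] with ω hω
  refine hApi.tendsto_probabilityMeasure_of_tendsto_of_mem hAm hAn fun s hs => ?_
  rw [← NNReal.tendsto_coe]
  have h1 := hω s hs
  rw [integral_indicator_const _ (hAm s hs), smul_eq_mul, mul_one] at h1
  refine h1.congr' ?_
  filter_upwards [eventually_ge_atTop 1] with n hn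
  have h2 : (empiricalLaw (fun i => X i ω) n : Measure (E k)).real s =
      (∑ i : Fin n, s.indicator (fun _ => (1 : ℝ)) (X i ω)) / n := by
    have h3 := integral_indicator_const (μ := sampleLaw (fun i : Fin n => X i ω) Finset.univ)
      (1 : ℝ) (hAm s hs)
    rw [integral_sampleLaw, smul_eq_mul, smul_eq_mul, mul_one] at h3
    rw [toMeasure_empiricalLaw _ hn, empiricalMeasure_eq_sampleLaw, ← h3]
    simp [div_eq_inv_mul]
  rw [← h2]
  rfl

end AlmostSure

/-! ### Consequences of nondegeneracy -/

theorem posDef_covOf {ν : Measure (E k)} [IsProbabilityMeasure ν]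
    (h : MemLp (fun x : E k => x) 2 ν) {l : ℝ} (hl : 0 < l)
    (hlow : ∀ (a : E k) (b : ℝ), l * (‖a‖ ^ 2 + b ^ 2) ≤ ∫ x, (inner ℝ a x - b) ^ 2 ∂ν) :
    (covOf ν).PosDef := by
  refine .of_dotProduct_mulVec_pos covOf_isHermitian fun {x} hx => ?_
  have h1 := hlow (WithLp.toLp 2 x) (inner ℝ (WithLp.toLp 2 x) (meanOf ν))
  rw [← mahal_covOf h] at h1
  simp only [mahal, sub_zero] at h1
  have h2 : 0 < ‖WithLp.toLp 2 x‖ := norm_pos_iff.2 (by simpa using hx)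
  simp only [star_trivial]
  refine lt_of_lt_of_le ?_ h1
  positivity

/-- Take `a` the mean and `b = ‖a‖²`: the variance along `a` is at least `l (‖a‖² + ‖a‖⁴)` and at
most `‖a‖²` times the trace. -/
theorem norm_meanOf_sq_le {ν : Measure (E k)} [IsProbabilityMeasure ν]
    (h : MemLp (fun x : E k => x) 2 ν) {l : ℝ} (hl : 0 < l)
    (hlow : ∀ (a : E k) (b : ℝ), l * (‖a‖ ^ 2 + b ^ 2) ≤ ∫ x, (inner ℝ a x - b) ^ 2 ∂ν) :
    ‖meanOf ν‖ ^ 2 ≤ (covOf ν).trace / l := by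
  have h1 := hlow (meanOf ν) (inner ℝ (meanOf ν) (meanOf ν))
  rw [← mahal_covOf h, real_inner_self_eq_norm_sq] at h1
  have h2 := mahal_covOf_le h (meanOf ν)
  have h3 := (covOf_posSemidef h).trace_nonneg
  rw [le_div_iff₀ hl]
  rcases eq_or_ne (‖meanOf ν‖ ^ 2) 0 with h0 | h0
  · rw [h0, zero_mul]; exact h3
  · have hpos : 0 < ‖meanOf ν‖ ^ 2 := lt_of_le_of_ne (sq_nonneg _) h0.symm
    refine le_of_mul_le_mul_left ?_ hpos
    nlinarith [mul_nonneg hl.le hpos.le]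

theorem trace_covOf_le {ν : Measure (E k)} [IsProbabilityMeasure ν]
    (h : MemLp (fun x : E k => x) 2 ν) {l D : ℝ} (hl : 0 < l)
    (hlow : ∀ (a : E k) (b : ℝ), l * (‖a‖ ^ 2 + b ^ 2) ≤ ∫ x, (inner ℝ a x - b) ^ 2 ∂ν)
    (hD : (covOf ν).det ≤ D) :
    (covOf ν).trace ≤ k * (D / l ^ (k - 1)) := by
  refine trace_le_of_det_le (covOf_posSemidef h) hl (fun a => ?_) hD
  rw [mahal_covOf h]
  refine le_trans ?_ (hlow a _)
  gcongr
  linarith [sq_nonneg (inner ℝ a (meanOf ν))]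

theorem isTrimming_of_integrable_mahal {P : Measure (E k)} [IsProbabilityMeasure P] {γ : ℝ}
    {V : Matrix (Fin k) (Fin k) ℝ} (hV : V.PosDef) (m : E k) {φ : E k → ℝ} (hφ : Measurable φ)
    (hφI : ∀ x, φ x ∈ Set.Icc (0 : ℝ) 1) (hmass : γ ≤ ∫ x, φ x ∂P)
    (hi : Integrable (fun x => φ x * mahal m V⁻¹ x) P) : IsTrimming P γ φ := by
  refine ⟨hφ, hφI, hmass, ?_⟩
  obtain ⟨c, hc, hcm⟩ := exists_normSq_le_mahal hV
  refine Integrable.mono' ((hi.const_mul (2 * c)).add (integrable_const (2 * ‖m‖ ^ 2)))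
    (by fun_prop) (ae_of_all _ fun x => ?_)
  have h0 := (hφI x).1
  have h1 := (hφI x).2
  rw [Real.norm_eq_abs, abs_of_nonneg (mul_nonneg (sq_nonneg _) h0), mul_comm]
  have h2 : ‖x‖ ^ 2 ≤ 2 * ‖x - m‖ ^ 2 + 2 * ‖m‖ ^ 2 := by
    have : ‖x‖ ≤ ‖x - m‖ + ‖m‖ := by simpa using norm_add_le (x - m) m
    nlinarith [norm_nonneg x, sq_nonneg (‖x - m‖ - ‖m‖), norm_nonneg (x - m), norm_nonneg m]
  simp only [Pi.add_apply]
  calc φ x * ‖x‖ ^ 2 ≤ φ x * (2 * (c * mahal m V⁻¹ x) + 2 * ‖m‖ ^ 2) := by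
        gcongr; linarith [hcm m x]
    _ = 2 * c * (φ x * mahal m V⁻¹ x) + φ x * (2 * ‖m‖ ^ 2) := by ring
    _ ≤ 2 * c * (φ x * mahal m V⁻¹ x) + 2 * ‖m‖ ^ 2 := by
        have := mul_le_of_le_one_left (b := 2 * ‖m‖ ^ 2) (by positivity) h1
        linarith

theorem integral_mul_mahal_trimmed {P : Measure (E k)} [IsProbabilityMeasure P] {γ : ℝ}
    (hγ : 0 < γ) {φ : E k → ℝ} (h : IsTrimming P γ φ) (m : E k) (W : Matrix (Fin k) (Fin k) ℝ) :
    (∫ x, φ x ∂P)⁻¹ * ∫ x, φ x * mahal m W x ∂P =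
      (W * trimmedCov P φ).trace + mahal m W (trimmedMean P φ) := by
  have hν := isTrimmedLaw_trimLaw hγ h
  have := hν.prob
  rw [← covOf_trimLaw h, ← meanOf_trimLaw h, ← integral_mahal hν.memLp, integral_trimLaw h]
  rfl

theorem IsTrimming.integrable_mul_mahal {P : Measure (E k)} [IsProbabilityMeasure P] {γ : ℝ}
    (hγ : 0 < γ) {φ : E k → ℝ} (h : IsTrimming P γ φ) (m : E k) (W : Matrix (Fin k) (Fin k) ℝ) :
    Integrable (fun x => φ x * mahal m W x) P := by
  have hν := isTrimmedLaw_trimLaw hγ h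
  have := hν.prob
  exact (integrable_trimLaw_iff hγ h).1 (integrable_mahal hν.memLp m W)

/-! ### The asymptotic upper bound for the minimal determinant -/

/-- The subset with the lowest form values has average at most `k t`, hence at most `k` for the form
of `t • V`, and `det (t • V) = t ^ k * det V`. -/
theorem det_sampleCov_le_of_weight {n : ℕ} {x : Fin n → E k} {γ : ℝ} (hγ : 0 < γ) (hγ1 : γ ≤ 1)
    (hn : 1 ≤ n) {S : Finset (Fin n)} (hS : IsMinimizingSubsample γ x S)
    {V : Matrix (Fin k) (Fin k) ℝ} (hV : V.PosDef) (m : E k) {t : ℝ} (ht : 0 < t)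
    {w : Fin n → ℝ} (hw : ∀ i, w i ∈ Set.Icc (0 : ℝ) 1) (hw1 : (⌈(n : ℝ) * γ⌉₊ : ℝ) ≤ ∑ i, w i)
    (hw2 : ∑ i, w i * mahal m V⁻¹ (x i) ≤ k * t * ∑ i, w i) :
    (sampleCov x S).det ≤ t ^ k * V.det := by
  have hn0 : (0 : ℝ) < n := by exact_mod_cast hn
  have hh0 : 0 < ⌈(n : ℝ) * γ⌉₊ := Nat.ceil_pos.2 (by positivity)
  have hhn : ⌈(n : ℝ) * γ⌉₊ ≤ Fintype.card (Fin n) := by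
    rw [Fintype.card_fin]
    exact Nat.ceil_le.2 (mul_le_of_le_one_right hn0.le hγ1)
  obtain ⟨S', hS', hlow⟩ := exists_lowest_subset (fun i => mahal m V⁻¹ (x i)) hh0 hhn
  refine (hS.2 S' hS'.ge).trans ?_
  obtain ⟨hne, hν⟩ := isTrimmedLaw_sampleLaw x hγ hn hS'.ge
  have := hν.prob
  have hcard : (0 : ℝ) < S'.card := by exact_mod_cast hne.card_pos
  have hsum : 0 < ∑ i, w i := lt_of_lt_of_le (by exact_mod_cast hh0) hw1
  have havg : (S'.card : ℝ)⁻¹ * ∑ i ∈ S', mahal m V⁻¹ (x i) ≤ k * t := by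
    have h1 := hlow w hw hw1
    rw [inv_mul_le_iff₀ hcard]
    refine le_of_mul_le_mul_right ?_ hsum
    rw [hS']
    refine h1.trans ?_
    rw [mul_assoc]
    gcongr
  have hinv : (t • V)⁻¹ = t⁻¹ • V⁻¹ := Matrix.inv_eq_right_inv (by
    rw [smul_mul_smul_comm, mul_inv_cancel₀ ht.ne', one_smul,
      Matrix.mul_nonsing_inv _ hV.det_pos.ne'.isUnit])
  have hmah : ∀ y, mahal m (t • V)⁻¹ y = t⁻¹ * mahal m V⁻¹ y := fun y => by
    simp [hinv, mahal, Matrix.smul_mulVec]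
  have key := (det_le_det_of_trace_le (hV.smul ht) (covOf_posSemidef hν.memLp)
    (meanOf (sampleLaw x S')) m (by
      rw [← integral_mahal hν.memLp]
      simp_rw [hmah]
      rw [integral_const_mul, integral_sampleLaw, smul_eq_mul, inv_mul_le_iff₀ ht, mul_comm t]
      exact havg)).1
  rwa [covOf_sampleLaw, Matrix.det_smul, Fintype.card_fin] at key

theorem posDef_trimmedCov {P : ProbabilityMeasure (E k)} {γ : ℝ} (hγ : 0 < γ)
    (hP : HyperplaneCondition (P : Measure (E k)) γ) {φ : E k → ℝ}
    (hφ : IsTrimming (P : Measure (E k)) γ φ) : (trimmedCov (P : Measure (E k)) φ).PosDef := by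
  obtain ⟨l, hl, h⟩ := exists_eventually_le_integral_sq P hγ hP
  have hν := isTrimmedLaw_trimLaw hγ hφ
  have := hν.prob
  rw [← covOf_trimLaw hφ]
  exact posDef_covOf hν.memLp hl (h.self_of_nhds _ hν)

theorem ae_eventually_det_le {Ω : Type*} [MeasurableSpace Ω] {μ : Measure Ω}
    {P₀ : ProbabilityMeasure (E k)} {X : ℕ → Ω → E k}
    (hXlaw : ∀ i, HasLaw (X i) (P₀ : Measure (E k)) μ) (hXindep : iIndepFun X μ)
    {γ : ℝ} (hγ : 0 < γ) (hγ1 : γ ≤ 1) (hP : HyperplaneCondition (P₀ : Measure (E k)) γ)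
    {φ : E k → ℝ} (hφ : IsTrimming (P₀ : Measure (E k)) γ φ) {t : ℝ} (ht : 1 < t) :
    ∀ᵐ ω ∂μ, ∀ᶠ n : ℕ in atTop, ∀ S : Finset (Fin n),
      IsMinimizingSubsample γ (fun i : Fin n => X i ω) S →
        (sampleCov (fun i : Fin n => X i ω) S).det ≤
          t ^ k * (trimmedCov (P₀ : Measure (E k)) φ).det := by
  -- In dimension zero all determinants are `1`; otherwise `k < k * t` leaves the room needed by
  -- `exists_weight`.
  rcases Nat.eq_zero_or_pos k with rfl | hk
  · simp
  have hk0 : (0 : ℝ) < k := by exact_mod_cast hk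
  have ht0 : 0 < t := one_pos.trans ht
  have hV := posDef_trimmedCov hγ hP hφ
  set m := trimmedMean (P₀ : Measure (E k)) φ
  set V := trimmedCov (P₀ : Measure (E k)) φ with hVdef
  have hpos : 0 < ∫ x, φ x ∂(P₀ : Measure (E k)) := hγ.trans_le hφ.mass
  have hgm : Measurable (mahal m V⁻¹) := measurable_mahal m V⁻¹
  have hκ : ∫ x, φ x * mahal m V⁻¹ x ∂(P₀ : Measure (E k)) ≤
      k * ∫ x, φ x ∂(P₀ : Measure (E k)) := by
    have h1 := integral_mul_mahal_trimmed hγ hφ m V⁻¹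
    rw [← hVdef, Matrix.nonsing_inv_mul _ hV.det_pos.ne'.isUnit, Matrix.trace_one,
      Fintype.card_fin, inv_mul_eq_iff_eq_mul₀ hpos.ne'] at h1
    rw [h1, mul_comm]
    simp [mahal, m]
  obtain ⟨w, hwm, hwI, hwg, hlt, hmass⟩ := exists_weight hφ.measurable hφ.mem_Icc hpos hgm
    (fun x => mahal_nonneg hV.inv.posSemidef m x) (hφ.integrable_mul_mahal hγ m V⁻¹) hκ
    (κ' := k * t) (by nlinarith)
  have hwi : Integrable w (P₀ : Measure (E k)) :=
    Integrable.of_bound (C := 1) hwm.aestronglyMeasurable (ae_of_all _ fun x => by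
      rw [Real.norm_eq_abs, abs_of_nonneg (hwI x).1]; exact (hwI x).2)
  filter_upwards [ae_tendsto_average hXlaw hXindep hwm hwi,
    ae_tendsto_average hXlaw hXindep (hwm.mul hgm) hwg] with ω h1 h2
  have hd := (h2.sub (h1.const_mul (k * t))).eventually_lt_const (sub_neg.2 hlt)
  have hm : ∀ᶠ n : ℕ in atTop, (⌈(n : ℝ) * γ⌉₊ : ℝ) ≤ ∑ i : Fin n, w (X i ω) := by
    rcases hmass with hmass | hmass
    · obtain ⟨d, hd1, hd2⟩ := exists_between (hφ.mass.trans_lt hmass)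
      -- For `n ≥ 1 / (d - γ)` one has `n d ≥ nγ + 1`, which exceeds `⌈nγ⌉`.
      filter_upwards [h1.eventually_const_lt hd2, eventually_ge_atTop 1,
        eventually_ge_atTop ⌈1 / (d - γ)⌉₊] with n hn hn1 hn2
      have hn0 : (0 : ℝ) < n := by exact_mod_cast hn1
      rw [lt_div_iff₀ hn0] at hn
      have h3 := Nat.ceil_le.1 hn2
      rw [div_le_iff₀ (sub_pos.2 hd1)] at h3
      have h4 := Nat.ceil_lt_add_one (a := (n : ℝ) * γ) (by positivity)
      nlinarith
    · refine Eventually.of_forall fun n => ?_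
      simp only [hmass, Finset.sum_const, Finset.card_univ, Fintype.card_fin, nsmul_eq_mul, mul_one]
      exact_mod_cast Nat.ceil_le.2 (mul_le_of_le_one_right n.cast_nonneg hγ1)
  filter_upwards [hd, hm, eventually_ge_atTop 1] with n hn1 hn2 hn S hS
  have hn0 : (0 : ℝ) < n := by exact_mod_cast hn
  refine det_sampleCov_le_of_weight hγ hγ1 hn hS hV m ht0 (fun i => hwI _) hn2 ?_
  simp only [Pi.mul_apply] at hn1
  rw [mul_div_assoc', ← sub_div, div_lt_iff₀ hn0, zero_mul, sub_neg] at hn1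
  exact hn1.le

/-! ### Convergence of location and scatter -/

/-- Matrices enter as moving parameters of the weak convergence lemmas. -/
instance : TopologicalSpace.PseudoMetrizableSpace (Matrix (Fin k) (Fin k) ℝ) :=
  inferInstanceAs (TopologicalSpace.PseudoMetrizableSpace (Fin k → Fin k → ℝ))

instance : SecondCountableTopology (Matrix (Fin k) (Fin k) ℝ) :=
  inferInstanceAs (SecondCountableTopology (Fin k → Fin k → ℝ))

theorem tendsto_matrix_inv {ι : Type*} {l : Filter ι} {V : ι → Matrix (Fin k) (Fin k) ℝ}
    {V₀ : Matrix (Fin k) (Fin k) ℝ} (h : Tendsto V l (𝓝 V₀)) (h0 : V₀.det ≠ 0) :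
    Tendsto (fun i => (V i)⁻¹) l (𝓝 V₀⁻¹) := by
  simp only [Matrix.inv_def, Ring.inverse_eq_inv']
  exact (((continuous_id.matrix_det.tendsto V₀).comp h).inv₀ h0).smul
    ((continuous_id.matrix_adjugate.tendsto V₀).comp h)

theorem tendsto_sampleMean_sampleCov {P₀ : ProbabilityMeasure (E k)} {γ : ℝ} (hγ : 0 < γ)
    (hγ1 : γ ≤ 1) (hP : HyperplaneCondition (P₀ : Measure (E k)) γ)
    (hunique : ∃! p, IsMCDFunctional (P₀ : Measure (E k)) γ p)
    {φ₀ : E k → ℝ} (hφ₀ : IsMinimizing (P₀ : Measure (E k)) γ φ₀)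
    {x : ℕ → E k} (hx : Tendsto (empiricalLaw x) atTop (𝓝 P₀))
    {S : (n : ℕ) → Finset (Fin n)}
    (hS : ∀ n, 1 ≤ n → IsMinimizingSubsample γ (fun i : Fin n => x i) (S n))
    (hdet : ∀ t : ℝ, 1 < t → ∀ᶠ n : ℕ in atTop, (sampleCov (fun i : Fin n => x i) (S n)).det ≤
      t ^ k * (trimmedCov (P₀ : Measure (E k)) φ₀).det) :
    Tendsto (fun n : ℕ => (sampleMean (fun i : Fin n => x i) (S n),
      sampleCov (fun i : Fin n => x i) (S n))) atTop
      (𝓝 (trimmedMean (P₀ : Measure (E k)) φ₀, trimmedCov (P₀ : Measure (E k)) φ₀)) := by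
  obtain ⟨l, hl, hev⟩ := exists_eventually_le_integral_sq P₀ hγ hP
  set T : ℕ → E k := fun n => sampleMean (fun i : Fin n => x i) (S n) with hT
  set C : ℕ → Matrix (Fin k) (Fin k) ℝ := fun n => sampleCov (fun i : Fin n => x i) (S n) with hC
  set ν : ℕ → Measure (E k) := fun n => sampleLaw (fun i : Fin n => x i) (S n) with hνdef
  set V₀ := trimmedCov (P₀ : Measure (E k)) φ₀
  have hmean : ∀ n, meanOf (ν n) = T n := fun n => meanOf_sampleLaw _
  have hcov : ∀ n, covOf (ν n) = C n := fun n => covOf_sampleLaw _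
  have htrim : ∀ n, 1 ≤ n → IsTrimmedLaw (empiricalLaw x n : Measure (E k)) γ (ν n) :=
    fun n hn => by
      rw [toMeasure_empiricalLaw x hn]
      exact (isTrimmedLaw_sampleLaw _ hγ hn (hS n hn).1).2
  have hlow : ∀ᶠ n in atTop, 1 ≤ n ∧ ∀ (a : E k) (b : ℝ),
      l * (‖a‖ ^ 2 + b ^ 2) ≤ ∫ y, (inner ℝ a y - b) ^ 2 ∂(ν n) := by
    filter_upwards [hx.eventually hev, eventually_ge_atTop 1] with n hn hn1
    exact ⟨hn1, hn _ (htrim n hn1)⟩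
  have hpd : ∀ᶠ n in atTop, (C n).PosDef := by
    filter_upwards [hlow] with n ⟨hn1, hn⟩
    have := (htrim n hn1).prob
    rw [← hcov]
    exact posDef_covOf (htrim n hn1).memLp hl hn
  -- The trace bound resulting from the determinant bound with `t = 2`.
  set M : ℝ := k * (2 ^ k * V₀.det / l ^ (k - 1))
  set K : Set (E k × Matrix (Fin k) (Fin k) ℝ) := Metric.closedBall 0 (Real.sqrt (M / l)) ×ˢ
    (Set.univ.pi fun _ => Set.univ.pi fun _ => Set.Icc (-M) M)
  have hK : IsCompact K := (isCompact_closedBall _ _).prod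
    (isCompact_univ_pi fun _ => isCompact_univ_pi fun _ => isCompact_Icc)
  have hmem : ∀ᶠ n in atTop, (T n, C n) ∈ K := by
    filter_upwards [hlow, hdet 2 one_lt_two] with n ⟨hn1, hn⟩ hd
    have := (htrim n hn1).prob
    have hm := (htrim n hn1).memLp
    have htr : (covOf (ν n)).trace ≤ M := trace_covOf_le hm hl hn (by rw [hcov]; exact hd)
    refine ⟨?_, fun i _ j _ => ?_⟩
    · rw [mem_closedBall_zero_iff, ← hmean]
      refine Real.le_sqrt_of_sq_le ((norm_meanOf_sq_le hm hl hn).trans ?_)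
      gcongr
    · rw [Set.mem_Icc, ← abs_le, ← hcov]
      exact (abs_covOf_le_trace hm i j).trans htr
  -- By compactness only cluster points need identification; an ultrafilter turns each into a
  -- genuine limit.
  refine hK.tendsto_nhds_of_unique_mapClusterPt hmem fun p _ hp => ?_
  obtain ⟨U, hU, hUp⟩ := mapClusterPt_iff_ultrafilter.1 hp
  obtain ⟨m, V⟩ := p
  have hTm : Tendsto T U (𝓝 m) := (continuous_fst.tendsto (m, V)).comp hUp
  have hCV : Tendsto C U (𝓝 V) := (continuous_snd.tendsto (m, V)).comp hUp
  have hV : V.PosDef := by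
    have hmahal : ∀ a : E k, l * ‖a‖ ^ 2 ≤ mahal 0 V a := fun a => by
      have hc : Continuous fun W : Matrix (Fin k) (Fin k) ℝ => mahal 0 W a := by
        simp only [mahal_eq_sum]
        fun_prop
      have h1 : Tendsto (fun n => mahal 0 (C n) a) U (𝓝 (mahal 0 V a)) :=
        (hc.tendsto V).comp hCV
      refine ge_of_tendsto h1 (hU ?_)
      filter_upwards [hlow] with n ⟨hn1, hn⟩
      have := (htrim n hn1).prob
      rw [← hcov, mahal_covOf (htrim n hn1).memLp]
      refine le_trans ?_ (hn a _)
      gcongr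
      linarith [sq_nonneg (inner ℝ a (meanOf (ν n)))]
    refine .of_dotProduct_mulVec_pos ?_ fun {y} hy => ?_
    · refine tendsto_nhds_unique ((continuous_id.matrix_conjTranspose.tendsto V).comp hCV)
        (hCV.congr' (hU ?_))
      filter_upwards [hpd] with n hn
      exact hn.1.symm
    · have h1 := hmahal (WithLp.toLp 2 y)
      simp only [mahal, sub_zero] at h1
      have h2 : 0 < ‖WithLp.toLp 2 y‖ := norm_pos_iff.2 (by simpa using hy)
      simp only [star_trivial]
      refine lt_of_lt_of_le ?_ h1
      positivity
  have hWV : Tendsto (fun n => (C n)⁻¹) U (𝓝 V⁻¹) := tendsto_matrix_inv hCV hV.det_pos.ne'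
  have hgm : Measurable (mahal m V⁻¹) := measurable_mahal m V⁻¹
  have hg0 : ∀ y, 0 ≤ mahal m V⁻¹ y := mahal_nonneg hV.inv.posSemidef m
  -- Each subsample law averages its own form to exactly `k`; the resulting inequality passes to the
  -- limit for each `c`.
  have hmax : ∀ c, γ * (c - k) ≤ ∫ y, max 0 (c - |mahal m V⁻¹ y|) ∂(P₀ : Measure (E k)) := by
    intro c
    have hlim := ((continuous_integral_max (Y := E k) (Θ := E k × Matrix (Fin k) (Fin k) ℝ)
      _ continuous_mahal c).tendsto (P₀, (m, V⁻¹))).comp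
        ((hx.mono_left hU).prodMk_nhds (hTm.prodMk_nhds hWV))
    refine ge_of_tendsto hlim (hU ?_)
    filter_upwards [hpd, eventually_ge_atTop 1] with n hn hn1
    have := (htrim n hn1).prob
    have hm := (htrim n hn1).memLp
    have h1 := (htrim n hn1).le_integral hγ.le (measurable_mahal (T n) (C n)⁻¹)
      (mahal_nonneg hn.inv.posSemidef (T n)) (integrable_mahal hm _ _) c
    have h2 : ∫ y, mahal (T n) (C n)⁻¹ y ∂(ν n) = k := by
      rw [integral_mahal hm, hcov, hmean, Matrix.nonsing_inv_mul _ hn.det_pos.ne'.isUnit]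
      simp [mahal]
    rw [← h2]
    exact h1
  obtain ⟨φ, hφm, hφI, hφ1, hφg, hφle⟩ := exists_trimming_integral_le hγ hgm hg0 hmax hγ1
  have hφ : IsTrimming (P₀ : Measure (E k)) γ φ :=
    isTrimming_of_integrable_mahal hV m hφm hφI hφ1 hφg
  have hφpos := hγ.trans_le hφ1
  have hφC := posDef_trimmedCov hγ hP hφ
  obtain ⟨hle, heq⟩ := det_le_det_of_trace_le hV hφC.posSemidef
    (trimmedMean (P₀ : Measure (E k)) φ) m (by
      rw [← integral_mul_mahal_trimmed hγ hφ, inv_mul_le_iff₀ hφpos, mul_comm]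
      exact hφle)
  have hVV₀ : V.det ≤ V₀.det := by
    have hdetlim : Tendsto (fun n => (C n).det) U (𝓝 V.det) :=
      (continuous_id.matrix_det.tendsto V).comp hCV
    have h1 : ∀ t : ℝ, 1 < t → V.det ≤ t ^ k * V₀.det := fun t ht =>
      le_of_tendsto hdetlim (hU (hdet t ht))
    have h2 : Tendsto (fun t : ℝ => t ^ k * V₀.det) (𝓝[>] 1) (𝓝 (1 ^ k * V₀.det)) :=
      Tendsto.mono_left (Continuous.tendsto (by fun_prop) 1) nhdsWithin_le_nhds
    rw [one_pow, one_mul] at h2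
    exact ge_of_tendsto h2 (eventually_nhdsWithin_of_forall h1)
  -- The chain `det C(φ) ≤ det V ≤ det V₀ ≤ det C(φ)` closes, which triggers the equality case.
  obtain ⟨e1, e2⟩ := heq (hVV₀.trans (hφ₀.2 φ hφ))
  have hmin : IsMinimizing (P₀ : Measure (E k)) γ φ :=
    ⟨hφ, fun ψ hψ => (hle.trans hVV₀).trans (hφ₀.2 ψ hψ)⟩
  have := hunique.unique ⟨φ, hmin, rfl⟩ ⟨φ₀, hφ₀, rfl⟩
  rw [← this, e1, e2]

/-! ### Convergence of the radius -/

theorem radius_nonneg (P : Measure (E k)) (γ : ℝ) (m : E k) (V : Matrix (Fin k) (Fin k) ℝ) :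
    0 ≤ radius P γ m V :=
  Real.sInf_nonneg fun _ hs => hs.1.le

theorem radius_le {P : Measure (E k)} {γ : ℝ} {m : E k} {V : Matrix (Fin k) (Fin k) ℝ} {s : ℝ}
    (hs : 0 < s) (h : γ ≤ P.real (ellipsoid m V s)) : radius P γ m V ≤ s :=
  csInf_le ⟨0, fun _ hs => hs.1.le⟩ ⟨hs, h⟩

/-- Above the limit radius, the boundary condition gives an open ellipsoid mass greater than `γ`;
below it, the open complement has mass greater than `1 - γ`. Both strict bounds persist under weak
convergence with moving centre and scatter. -/
theorem tendsto_radius {P₀ : ProbabilityMeasure (E k)} {γ : ℝ} (hγ : 0 < γ)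
    {ρ : ℕ → ProbabilityMeasure (E k)} (hρ : Tendsto ρ atTop (𝓝 P₀))
    {m : ℕ → E k} {m₀ : E k} {V : ℕ → Matrix (Fin k) (Fin k) ℝ} {V₀ : Matrix (Fin k) (Fin k) ℝ}
    (h : Tendsto (fun n => (m n, V n)) atTop (𝓝 (m₀, V₀))) (hV₀ : V₀.det ≠ 0)
    (hbd : ∀ ε : ℝ, 0 < ε → γ < (P₀ : Measure (E k)).real
      (ellipsoid m₀ V₀ (radius (P₀ : Measure (E k)) γ m₀ V₀ + ε))) :
    Tendsto (fun n => radius (ρ n : Measure (E k)) γ (m n) (V n)) atTop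
      (𝓝 (radius (P₀ : Measure (E k)) γ m₀ V₀)) := by
  set r := radius (P₀ : Measure (E k)) γ m₀ V₀ with hr
  have hr0 : 0 ≤ r := radius_nonneg _ _ _ _
  have hθ : Tendsto (fun n => (m n, (V n)⁻¹)) atTop (𝓝 (m₀, V₀⁻¹)) :=
    ((continuous_fst.tendsto _).comp h).prodMk_nhds
      (tendsto_matrix_inv ((continuous_snd.tendsto _).comp h) hV₀)
  have hup : ∀ ε : ℝ, 0 < ε → ∀ᶠ n in atTop,
      γ ≤ (ρ n : Measure (E k)).real (ellipsoid (m n) (V n) (r + ε)) := fun ε hε => by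
    have hsub : ellipsoid m₀ V₀ (r + ε / 2) ⊆ {x | mahal m₀ V₀⁻¹ x < (r + ε) ^ 2} :=
      fun x (hx : mahal m₀ V₀⁻¹ x ≤ (r + ε / 2) ^ 2) => lt_of_le_of_lt hx (by nlinarith)
    have h1 := eventually_lt_measureReal_of_isOpen hρ hθ
      (isOpen_lt continuous_mahal (continuous_const (y := (r + ε) ^ 2))) hγ.le
      ((hbd (ε / 2) (by positivity)).trans_le (measureReal_mono hsub))
    filter_upwards [h1] with n hn
    refine hn.le.trans (measureReal_mono fun x hx => ?_)
    exact le_of_lt (show mahal (m n) (V n)⁻¹ x < (r + ε) ^ 2 from hx)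
  refine tendsto_order.2 ⟨fun a ha => ?_, fun a ha => ?_⟩
  · obtain ⟨s, has, hsr⟩ := exists_between ha
    rcases le_or_gt s 0 with hs | hs
    · exact Eventually.of_forall fun n => (has.trans_le hs).trans_le (radius_nonneg _ _ _ _)
    have hlt : (P₀ : Measure (E k)).real (ellipsoid m₀ V₀ s) < γ := by
      by_contra! hle
      exact absurd (radius_le hs hle) (not_le.2 hsr)
    have hγ1 : γ < 1 := (hbd 1 one_pos).trans_le measureReal_le_one
    have hcompl : ∀ (Q : ProbabilityMeasure (E k)) (m : E k) (V : Matrix (Fin k) (Fin k) ℝ),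
        (Q : Measure (E k)).real {x | s ^ 2 < mahal m V⁻¹ x} =
          1 - (Q : Measure (E k)).real (ellipsoid m V s) := fun Q m V => by
      have hm : MeasurableSet (ellipsoid m V s) :=
        measurableSet_le (measurable_mahal m V⁻¹) measurable_const
      rw [← probReal_compl_eq_one_sub hm]
      congr 1
      ext x
      exact (not_le (a := mahal m V⁻¹ x) (b := s ^ 2)).symm
    have h1 := eventually_lt_measureReal_of_isOpen hρ hθ (r := 1 - γ)
      (isOpen_lt (continuous_const (y := s ^ 2)) continuous_mahal) (by linarith) (by
        refine lt_of_lt_of_eq ?_ (hcompl P₀ m₀ V₀).symm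
        linarith)
    filter_upwards [h1, hup 1 one_pos] with n hn hn2
    have h2 : (ρ n : Measure (E k)).real (ellipsoid (m n) (V n) s) < γ := by
      have := lt_of_lt_of_eq hn (hcompl (ρ n) (m n) (V n))
      linarith
    -- The point `r + 1` keeps the defining set nonempty; otherwise its infimum would default to
    -- `0`.
    refine has.trans_le (le_csInf ⟨r + 1, by positivity, hn2⟩ fun u hu => ?_)
    by_contra! hus
    refine absurd (hu.2.trans (measureReal_mono fun x hx => ?_)) (not_le.2 h2)
    exact le_trans (show mahal (m n) (V n)⁻¹ x ≤ u ^ 2 from hx)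
      (by have := hu.1; gcongr)
  · have hε : 0 < (a - r) / 2 := by linarith
    filter_upwards [hup _ hε] with n hn
    exact (radius_le (by linarith) hn).trans_lt (by linarith)

end MCD

end

/-! ### Almost sure convergence of the estimators -/

theorem mainTheorem7 {k : ℕ} {Ω : Type*} [MeasurableSpace Ω]
    (μ : Measure Ω) [IsProbabilityMeasure μ]
    (P₀ : Measure (MCD.E k)) [IsProbabilityMeasure P₀]
    (γ : ℝ) (hγ0 : 0 < γ) (hγ1 : γ ≤ 1)
    (X : ℕ → Ω → MCD.E k) (hXlaw : ∀ i, HasLaw (X i) P₀ μ) (hXindep : iIndepFun X μ)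
    (hP₀ : MCD.HyperplaneCondition P₀ γ)
    (hunique : ∃! p, MCD.IsMCDFunctional P₀ γ p)
    (φ₀ : MCD.E k → ℝ) (hφ₀ : MCD.IsMinimizing P₀ γ φ₀)
    (S : (n : ℕ) → Ω → Finset (Fin n))
    (hS : ∀ n, 1 ≤ n → ∀ᵐ ω ∂μ,
      MCD.IsMinimizingSubsample γ (fun i : Fin n => X i ω) (S n ω)) :
    (∀ᵐ ω ∂μ, Tendsto
      (fun n : ℕ => (MCD.sampleMean (fun i : Fin n => X i ω) (S n ω),
        MCD.sampleCov (fun i : Fin n => X i ω) (S n ω)))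
      atTop (𝓝 (MCD.trimmedMean P₀ φ₀, MCD.trimmedCov P₀ φ₀))) ∧
    (MCD.BoundaryCondition P₀ γ φ₀ →
      ∀ᵐ ω ∂μ, Tendsto
        (fun n : ℕ => MCD.sampleRadius γ (fun i : Fin n => X i ω) (S n ω))
        atTop (𝓝 (MCD.trimmedRadius P₀ γ φ₀))) := by
  set Q : ProbabilityMeasure (MCD.E k) := ⟨P₀, inferInstance⟩
  have hS' : ∀ᵐ ω ∂μ, ∀ n, 1 ≤ n →
      MCD.IsMinimizingSubsample γ (fun i : Fin n => X i ω) (S n ω) :=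
    ae_all_iff.2 fun n => by
      by_cases hn : 1 ≤ n
      · filter_upwards [hS n hn] with ω hω _ using hω
      · exact ae_of_all _ fun ω h => absurd h hn
  have hweak := MCD.ae_tendsto_empiricalLaw hXlaw hXindep
  -- Only countably many `t = 1 + 1 / (j + 1)` are used, so that one null set serves all `t > 1`.
  have hdet : ∀ᵐ ω ∂μ, ∀ j : ℕ, ∀ᶠ n : ℕ in atTop, ∀ S : Finset (Fin n),
      MCD.IsMinimizingSubsample γ (fun i : Fin n => X i ω) S →
        (MCD.sampleCov (fun i : Fin n => X i ω) S).det ≤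
          (1 + 1 / ((j : ℝ) + 1)) ^ k * (MCD.trimmedCov P₀ φ₀).det :=
    ae_all_iff.2 fun j => MCD.ae_eventually_det_le (P₀ := Q) hXlaw hXindep hγ0 hγ1 hP₀ hφ₀.1
      (by simp; positivity)
  have hpd := MCD.posDef_trimmedCov (P := Q) hγ0 hP₀ hφ₀.1
  have hi : ∀ᵐ ω ∂μ, Tendsto
      (fun n : ℕ => (MCD.sampleMean (fun i : Fin n => X i ω) (S n ω),
        MCD.sampleCov (fun i : Fin n => X i ω) (S n ω)))
      atTop (𝓝 (MCD.trimmedMean P₀ φ₀, MCD.trimmedCov P₀ φ₀)) := by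
    filter_upwards [hS', hweak, hdet] with ω h1 h2 h3
    refine MCD.tendsto_sampleMean_sampleCov (P₀ := Q) (x := fun i => X i ω) hγ0 hγ1 hP₀
      hunique hφ₀ h2 h1 fun t ht => ?_
    obtain ⟨j, hj⟩ := exists_nat_one_div_lt (sub_pos.2 ht)
    filter_upwards [h3 j, eventually_ge_atTop 1] with n hn hn1
    refine (hn _ (h1 n hn1)).trans ?_
    have := hpd.det_pos.le
    refine mul_le_mul_of_nonneg_right ?_ this
    gcongr
    linarith
  refine ⟨hi, fun hbd => ?_⟩
  filter_upwards [hi, hweak] with ω h1 h2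
  refine (MCD.tendsto_radius (P₀ := Q) hγ0 h2 h1 hpd.det_pos.ne' hbd).congr' ?_
  filter_upwards [eventually_ge_atTop 1] with n hn
  rw [MCD.toMeasure_empiricalLaw _ hn]
  rfl
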